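/- Let $(V,h)$ be a quadratic space: $V$ is a real vector space of finite dimension $m\ge 1$ and $h$ is a non-degenerate quadratic form on $V$, of any signature. Let $\mathrm{Cl}(h)=\mathrm{Cl}^0(h)\oplus \mathrm{Cl}^1(h)$ be its real Clifford algebra, with $v^2=h(v)$ for $v\in V$, and let $\alpha$ be the automorphism of $\mathrm{Cl}(h)$ with $\alpha(v)=-v$. Let $\rho:\mathrm{Cl}(h)\to\mathrm{End}\,S$ be the following complex representation. - If $m=2n$ is even, $\rho$ is a Dirac representation, i.e. faithful and irreducible with $\dim_{\mathbb C} S=2^n$. - If $m=2n-1$ is odd, $\rho$ is a Cartan representation, i.e. equivalent to $\sigma\oplus(\sigma\circ\alpha)$ on $S_0\oplus S_0$, where $\sigma$ is a representation of $\mathrm{Cl}(h)$ in a complex vector space $S_0$ of dimension $2^{n-1}$ whose restriction to $\mathrm{Cl}^0(h)$ is faithful and irreducible. Identify $V$ and $\mathrm{Cl}(h)$ with their images in $\mathrm{End}\,S$. Let $\mathrm{Pin}(h)$ be the group generated by all $v\in V$ with $v^2=\pm1$, let $\mathrm{Spin}(h)=\mathrm{Pin}(h)\cap \mathrm{Cl}^0(h)$,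 and let $\mathrm{Lpin}(h)=\{a\in \mathrm{GL}(S): aVa^{-1}=V\}$. For $G=\mathrm{Pin}(h)$ or $\mathrm{Spin}(h)$ put $\mathbb C^\times\cdot G=(\mathbb C^\times\times G)/\{(1,1),(-1,-1)\}$. Let $A(h)=\{w\in\mathrm{End}\,S: wv+vw=0 \text{ for all } v\in V\}$. Then there is a quadratic form $h_0$ on the complex vector space $A(h)$ such that $w^2=h_0(w)\,\mathrm{id}_S$ for all $w\in A(h)$. Let $\kappa:\mathrm{Lpin}(h)\to \mathrm{O}(h_0,\mathbb C)$ be the homomorphism $\kappa(a)w=awa^{-1}$. Let $\mathbb Z_2=\{1,-1\}$. (i) If $m$ is even, then $\mathrm O(h_0,\mathbb C)\cong\mathbb Z_2$ and, under a suitable isomorphism, there is a split exact sequence $$1\to\mathbb C^\times\cdot\mathrm{Spin}(h)\to\mathrm{Lpin}(h)\xrightarrow{\ \kappa\ }\mathbb Z_2\to1$$ whose first map is $[(\lambda,a)]\mapsto\lambda a$. Moreover $[(\lambda,a)]\mapsto\lambda a$ is an isomorphism $\mathbb C^\times\cdot\mathrm{Pin}(h)\cong\mathrm{Lpin}(h)$.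 (ii) If $m$ is odd, let $\mathbb Z_2\ltimes_\varphi\mathbb C^\times$ be the semidirect product with $\varphi(-1)z=z^{-1}$. There is an isomorphism $\mathrm O(h_0,\mathbb C)\cong\mathbb Z_2\ltimes_\varphi\mathbb C^\times$ such that, if $\kappa$ is regarded as a map into $\mathbb Z_2\ltimes_\varphi\mathbb C^\times$ and $q$ denotes the endomorphism $(\varepsilon,z)\mapsto(\varepsilon,z^2)$ of this group, there are exact sequences $$1\to\mathbb C^\times\cdot\mathrm{Pin}(h)\to\mathrm{Lpin}(h)\xrightarrow{\ q\circ\kappa\ }\mathbb Z_2\ltimes_\varphi\mathbb C^\times\to1,$$ $$1\to\mathbb C^\times\cdot\mathrm{Spin}(h)\to\mathrm{Lpin}(h)\xrightarrow{\ \kappa\ }\mathbb Z_2\ltimes_\varphi\mathbb C^\times\to1,$$ in both of which the first map is $[(\lambda,a)]\mapsto\lambda a$. Moreover there is an isomorphism of groups $$\bigl(\mathrm{Pin}(h)\ltimes_\psi(\mathbb C^\times\times\mathbb C^\times)\bigr)/\mathbb Z_2\cong\mathrm{Lpin}(h),$$ where $\psi(a)(\lambda,\mu)=(\mu,\lambda)$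 for $a\in\mathrm{Pin}(h)\setminus\mathrm{Spin}(h)$, $\psi(a)$ is the identity for $a\in\mathrm{Spin}(h)$, and $\mathbb Z_2$ is the subgroup $\{(1,1,1),(-1,-1,-1)\}$. -/

import Mathlib

open CliffordAlgebra

namespace Lipschitz

noncomputable section

/-! ### Pin and Spin groups of a real quadratic space, in the convention `v ^ 2 = h v` -/

section Groups

variable {V : Type*} [AddCommGroup V] [Module ℝ V] (Q : QuadraticForm ℝ V)

/-- `Pin(h)`: the group generated by all unit vectors, i.e. by the vectors `v` with
`v ^ 2 = 1` or `v ^ 2 = -1`. -/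
def pin : Subgroup (CliffordAlgebra Q)ˣ :=
  Subgroup.closure {u | ∃ v : V, (u : CliffordAlgebra Q) = ι Q v ∧ (Q v = 1 ∨ Q v = -1)}

theorem mem_even_iff (a : CliffordAlgebra Q) : a ∈ evenOdd Q 0 ↔ involute a = a := by
  refine ⟨fun h => involute_eq_of_mem_even h, fun h => ?_⟩
  have hc := (evenOdd_isCompl (Q := Q)).sup_eq_top
  have ha : a ∈ evenOdd Q 0 ⊔ evenOdd Q 1 := hc ▸ Submodule.mem_top
  obtain ⟨x, hx, y, hy, rfl⟩ := Submodule.mem_sup.1 ha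
  rw [map_add, involute_eq_of_mem_even hx, involute_eq_of_mem_odd hy] at h
  have h2 : -y = y := add_left_cancel h
  have h3 : (2 : ℝ) • y = 0 := by
    rw [two_smul]
    nth_rewrite 1 [← h2]
    simp
  have h4 : y = 0 := by simpa using h3
  simpa [h4] using hx

/-- `Spin(h) = Pin(h) ∩ Cl⁰(h)`. -/
def spin : Subgroup (CliffordAlgebra Q)ˣ where
  carrier := {a | a ∈ pin Q ∧ (a : CliffordAlgebra Q) ∈ evenOdd Q 0}
  one_mem' := ⟨one_mem _, by simp [mem_even_iff]⟩
  mul_mem' := by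
    rintro a b ⟨ha, ha'⟩ ⟨hb, hb'⟩
    rw [mem_even_iff] at ha' hb'
    exact ⟨mul_mem ha hb, by simp [mem_even_iff, ha', hb']⟩
  inv_mem' := by
    rintro a ⟨ha, ha'⟩
    rw [mem_even_iff] at ha'
    refine ⟨inv_mem ha, ?_⟩
    rw [mem_even_iff]
    have h : involute ((a⁻¹ : (CliffordAlgebra Q)ˣ) : CliffordAlgebra Q) *
        involute (a : CliffordAlgebra Q) = 1 := by
      rw [← map_mul, Units.inv_mul, map_one]
    rw [ha'] at h
    exact (Units.eq_inv_of_mul_eq_one_right h)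

theorem mem_spin_iff {a : (CliffordAlgebra Q)ˣ} :
    a ∈ spin Q ↔ a ∈ pin Q ∧ (a : CliffordAlgebra Q) ∈ evenOdd Q 0 := Iff.rfl

theorem involute_of_mem_pin {a : (CliffordAlgebra Q)ˣ} (ha : a ∈ pin Q) :
    involute (a : CliffordAlgebra Q) = a ∨ involute (a : CliffordAlgebra Q) = -a := by
  induction ha using Subgroup.closure_induction with
  | mem u hu =>
    obtain ⟨v, hv, -⟩ := hu
    right
    rw [hv, involute_ι]
  | one => left; simp
  | mul x y _ _ hx hy =>
    rcases hx with hx | hx <;> rcases hy with hy | hy <;> simp [hx, hy]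
  | inv x _ hx =>
    have h : involute ((x⁻¹ : (CliffordAlgebra Q)ˣ) : CliffordAlgebra Q) *
        involute (x : CliffordAlgebra Q) = 1 := by
      rw [← map_mul, Units.inv_mul, map_one]
    rcases hx with hx | hx
    · left
      rw [hx] at h
      exact Units.eq_inv_of_mul_eq_one_right h
    · right
      rw [hx, mul_neg, ← neg_mul] at h
      exact neg_eq_iff_eq_neg.1 (Units.eq_inv_of_mul_eq_one_right h)

theorem neg_ne (a : (CliffordAlgebra Q)ˣ) :
    -(a : CliffordAlgebra Q) ≠ (a : CliffordAlgebra Q) := by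
  intro h
  have h3 : (2 : ℝ) • (a : CliffordAlgebra Q) = 0 := by
    rw [two_smul]
    nth_rewrite 1 [← h]
    simp
  exact a.ne_zero ((smul_eq_zero.1 h3).resolve_left two_ne_zero)

theorem mul_mem_spin_iff (a b : pin Q) :
    ((a * b : pin Q) : (CliffordAlgebra Q)ˣ) ∈ spin Q ↔
      ((a : (CliffordAlgebra Q)ˣ) ∈ spin Q ↔ (b : (CliffordAlgebra Q)ˣ) ∈ spin Q) := by
  have ha := involute_of_mem_pin Q a.2
  have hb := involute_of_mem_pin Q b.2
  have na := neg_ne Q (a : (CliffordAlgebra Q)ˣ)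
  have nb := neg_ne Q (b : (CliffordAlgebra Q)ˣ)
  have nab := neg_ne Q ((a * b : pin Q) : (CliffordAlgebra Q)ˣ)
  simp only [mem_spin_iff, SetLike.coe_mem, true_and, mem_even_iff]
  rcases ha with ha | ha <;> rcases hb with hb | hb <;>
    simp_all [Subgroup.coe_mul, Units.val_mul]

/-- The automorphism `(x, y) ↦ (y, x)` of `ℂˣ × ℂˣ`. -/
def swapAut : MulAut (ℂˣ × ℂˣ) := MulEquiv.prodComm

open Classical in
/-- `ψ : Pin(h) → Aut (ℂˣ × ℂˣ)`: elements of `Spin(h)` act trivially, elements of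
`Pin(h) ∖ Spin(h)` act by `(x, y) ↦ (y, x)`. -/
def psi : pin Q →* MulAut (ℂˣ × ℂˣ) where
  toFun a := if (a : (CliffordAlgebra Q)ˣ) ∈ spin Q then 1 else swapAut
  map_one' := if_pos (one_mem _)
  map_mul' a b := by
    have h := mul_mem_spin_iff Q a b
    have hs : swapAut * swapAut = 1 := by
      ext x <;> rfl
    by_cases ha : (a : (CliffordAlgebra Q)ˣ) ∈ spin Q <;>
      by_cases hb : (b : (CliffordAlgebra Q)ˣ) ∈ spin Q <;>
      simp only [ha, hb, iff_true, iff_false, not_true_eq_false] at h <;>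
      simp only [ha, hb, h, if_true, if_false, one_mul, mul_one, hs]

theorem psi_neg_one (a : pin Q) : (psi Q a) (-1, -1) = (-1, -1) := by
  simp only [psi, MonoidHom.coe_mk, OneHom.coe_mk]
  split_ifs <;> rfl

/-- The subgroup `ℤ₂ = {(1, 1), (-1, -1)}` of `ℂˣ × P`. -/
def signPairs (P : Subgroup (CliffordAlgebra Q)ˣ) : Subgroup (ℂˣ × P) where
  carrier := {x | (x.1 = 1 ∧ (x.2 : (CliffordAlgebra Q)ˣ) = 1) ∨
    (x.1 = -1 ∧ (x.2 : (CliffordAlgebra Q)ˣ) = -1)}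
  one_mem' := Or.inl ⟨rfl, rfl⟩
  mul_mem' := by
    rintro a b (⟨h1, h2⟩ | ⟨h1, h2⟩) (⟨h3, h4⟩ | ⟨h3, h4⟩)
    · exact Or.inl ⟨by simp [h1, h3], by simp [Prod.snd_mul, h2, h4]⟩
    · exact Or.inr ⟨by simp [h1, h3], by simp [Prod.snd_mul, h2, h4]⟩
    · exact Or.inr ⟨by simp [h1, h3], by simp [Prod.snd_mul, h2, h4]⟩
    · exact Or.inl ⟨by simp [h1, h3], by simp [Prod.snd_mul, h2, h4]⟩
  inv_mem' := by
    rintro a (⟨h1, h2⟩ | ⟨h1, h2⟩)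
    · exact Or.inl ⟨by simp [h1], by simp [Prod.snd_inv, h2]⟩
    · exact Or.inr ⟨by simp [h1], by simp [Prod.snd_inv, h2]⟩

instance (P : Subgroup (CliffordAlgebra Q)ˣ) : (signPairs Q P).Normal where
  conj_mem := by
    rintro n (⟨h1, h2⟩ | ⟨h1, h2⟩) g
    · left
      simp [h1, h2]
    · right
      simp [h1, h2]

/-- `ℂˣ · P = (ℂˣ × P) / ℤ₂`. -/
abbrev ScalarDot (P : Subgroup (CliffordAlgebra Q)ˣ) : Type _ := (ℂˣ × P) ⧸ signPairs Q P

/-- The subgroup `ℤ₂ = {1, (-1, (-1, -1))}` of the semidirect product of `Pin(h)` and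
`ℂˣ × ℂˣ` defined by `psi`. -/
def signTriples : Subgroup ((ℂˣ × ℂˣ) ⋊[psi Q] pin Q) where
  carrier := {x | (x.left = 1 ∧ (x.right : (CliffordAlgebra Q)ˣ) = 1) ∨
    (x.left = (-1, -1) ∧ (x.right : (CliffordAlgebra Q)ˣ) = -1)}
  one_mem' := Or.inl ⟨rfl, rfl⟩
  mul_mem' := by
    rintro a b (⟨h1, h2⟩ | ⟨h1, h2⟩) (⟨h3, h4⟩ | ⟨h3, h4⟩)
    · exact Or.inl ⟨by simp [h1, h3], by simp [h2, h4]⟩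
    · exact Or.inr ⟨by simp [h1, h3, psi_neg_one], by simp [h2, h4]⟩
    · exact Or.inr ⟨by simp [h1, h3], by simp [h2, h4]⟩
    · exact Or.inl ⟨by simp [h1, h3, psi_neg_one], by simp [h2, h4]⟩
  inv_mem' := by
    rintro a (⟨h1, h2⟩ | ⟨h1, h2⟩)
    · left
      simp [h1, h2]
    · right
      refine ⟨?_, by simp [h2]⟩
      rw [SemidirectProduct.inv_left, h1]
      have : ((-1, -1) : ℂˣ × ℂˣ)⁻¹ = (-1, -1) := by ext <;> simp
      rw [this, psi_neg_one]

instance : (signTriples Q).Normal where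
  conj_mem := by
    rintro n (⟨h1, h2⟩ | ⟨h1, h2⟩) g
    · left
      have h2' : n.right = 1 := Subtype.ext h2
      have : n = 1 := SemidirectProduct.ext h1 h2'
      simp [this]
    · right
      have hn : ∀ p : pin Q, n.right * p = p * n.right := by
        intro p
        apply Subtype.ext
        simp [h2]
      have hone : psi Q n.right = 1 := by
        have : (n.right : (CliffordAlgebra Q)ˣ) ∈ spin Q := by
          rw [mem_spin_iff]
          refine ⟨n.right.2, ?_⟩
          rw [h2, mem_even_iff]
          simp
        simp [psi, this]
      constructor
      · simp only [SemidirectProduct.mul_left, SemidirectProduct.mul_right,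
          SemidirectProduct.inv_left, map_mul, hone, h1, psi_neg_one, map_inv, MulAut.mul_apply,
          MulAut.one_apply, MulAut.apply_inv_self]
        rw [mul_right_comm, mul_inv_cancel, one_mul]
      · simp only [SemidirectProduct.mul_right, SemidirectProduct.inv_right]
        rw [← hn, mul_assoc, mul_inv_cancel, mul_one, h2]

/-- The group `(Pin(h) ⋉_ψ (ℂˣ × ℂˣ)) / ℤ₂`. -/
abbrev PinSwap : Type _ := ((ℂˣ × ℂˣ) ⋊[psi Q] pin Q) ⧸ signTriples Q

end Groups

/-! ### The group `ℤ₂ ⋉_φ ℂˣ` -/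

/-- `φ : ℤ₂ → Aut ℂˣ` with `φ(-1) z = z⁻¹`; here `ℤ₂ = {1, -1}` is `ℤˣ`, and
`φ(ε) z = z ^ ε`. -/
def phi : ℤˣ →* MulAut ℂˣ where
  toFun ε :=
    { toFun := fun z => z ^ (ε : ℤ)
      invFun := fun z => z ^ (ε : ℤ)
      left_inv := fun z => by
        change (z ^ (ε : ℤ)) ^ (ε : ℤ) = z
        rw [← zpow_mul, ← Units.val_mul, Int.units_mul_self, Units.val_one, zpow_one]
      right_inv := fun z => by
        change (z ^ (ε : ℤ)) ^ (ε : ℤ) = z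
        rw [← zpow_mul, ← Units.val_mul, Int.units_mul_self, Units.val_one, zpow_one]
      map_mul' := fun z w => mul_zpow z w _ }
  map_one' := by ext z; simp
  map_mul' a b := by
    ext z
    simp only [MulAut.mul_apply, MulEquiv.coe_mk, Equiv.coe_fn_mk]
    rw [← zpow_mul, mul_comm, Units.val_mul]

/-- The endomorphism `(ε, z) ↦ (ε, z ^ 2)` of `ℤ₂ ⋉_φ ℂˣ`. -/
def squareRight : ℂˣ ⋊[phi] ℤˣ →* ℂˣ ⋊[phi] ℤˣ :=
  SemidirectProduct.map (powMonoidHom 2) (MonoidHom.id ℤˣ) (by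
    intro g
    ext z : 1
    change (z ^ (g : ℤ)) ^ 2 = (z ^ 2) ^ (g : ℤ)
    rw [← zpow_natCast, ← zpow_natCast, ← zpow_mul, ← zpow_mul, mul_comm])

/-- The group of all linear automorphisms preserving a quadratic form. -/
def orthogonalGroup {M : Type*} [AddCommGroup M] [Module ℂ M] (q : QuadraticForm ℂ M) :
    Subgroup (M ≃ₗ[ℂ] M) where
  carrier := {T | ∀ x, q (T x) = q x}
  one_mem' := fun _ => rfl
  mul_mem' := fun {a b} ha hb x => by
    rw [LinearEquiv.mul_apply, ha, hb]
  inv_mem' := fun {a} ha x => by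
    rw [← ha (a⁻¹ x), ← LinearEquiv.mul_apply, mul_inv_cancel]; rfl

/-! ### Spinor representations and the Lipschitz group -/

section Spinor

variable {V : Type*} [AddCommGroup V] [Module ℝ V] {Q : QuadraticForm ℝ V}
  {S : Type*} [AddCommGroup S] [Module ℂ S]

/-- Dirac representation, for `dim V = 2 n`: the faithful and irreducible complex
representation of `Cl(h)`, of dimension `2 ^ n`. -/
structure IsDirac (ρ : CliffordAlgebra Q →ₐ[ℝ] Module.End ℂ S) : Prop where
  finrank_eq : Module.finrank ℂ S = 2 ^ (Module.finrank ℝ V / 2)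
  faithful : Function.Injective ρ
  irreducible : ∀ W : Submodule ℂ S, (∀ a, ∀ s ∈ W, ρ a s ∈ W) → W = ⊥ ∨ W = ⊤

/-- Extended Pauli representation, for `dim V = 2 n - 1`: a complex representation of `Cl(h)`,
of dimension `2 ^ (n - 1)`, whose restriction to the even subalgebra `Cl⁰(h)` is faithful and
irreducible. -/
structure IsPauli (σ : CliffordAlgebra Q →ₐ[ℝ] Module.End ℂ S) : Prop where
  finrank_eq : Module.finrank ℂ S = 2 ^ (Module.finrank ℝ V / 2)
  faithful : ∀ a ∈ evenOdd Q 0, σ a = 0 → a = 0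
  irreducible : ∀ W : Submodule ℂ S,
    (∀ a ∈ evenOdd Q 0, ∀ s ∈ W, σ a s ∈ W) → W = ⊥ ∨ W = ⊤

/-- Cartan representation, for `dim V = 2 n - 1`: a representation equivalent to
`σ ⊕ σ ∘ α` on `S₀ ⊕ S₀`, where `σ` is an extended Pauli representation on
`S₀ = ℂ ^ (2 ^ (n - 1))` and `α` is the grading automorphism of `Cl(h)`. -/
def IsCartan (ρ : CliffordAlgebra Q →ₐ[ℝ] Module.End ℂ S) : Prop :=
  ∃ σ : CliffordAlgebra Q →ₐ[ℝ] Module.End ℂ (Fin (2 ^ (Module.finrank ℝ V / 2)) → ℂ),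
    IsPauli σ ∧
    ∃ e : S ≃ₗ[ℂ] (Fin (2 ^ (Module.finrank ℝ V / 2)) → ℂ) ×
        (Fin (2 ^ (Module.finrank ℝ V / 2)) → ℂ),
      ∀ a s, e (ρ a s) = (σ a (e s).1, σ (involute a) (e s).2)

variable (ρ : CliffordAlgebra Q →ₐ[ℝ] Module.End ℂ S)

/-- The image of `V` in `End S`. -/
def vectors : Set (Module.End ℂ S) := Set.range fun v : V => ρ (ι Q v)

/-- The Lipschitz group `Lpin(h) = {a ∈ GL(S) | a V a⁻¹ = V}`. -/
def lpin : Subgroup (Module.End ℂ S)ˣ where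
  carrier := {a | (fun x => (a : Module.End ℂ S) * x * ((a⁻¹ : (Module.End ℂ S)ˣ) :
    Module.End ℂ S)) '' vectors ρ = vectors ρ}
  one_mem' := by simp
  mul_mem' := by
    intro a b ha hb
    simp only [Set.mem_ofPred_eq] at ha hb ⊢
    conv_rhs => rw [← ha, ← hb]
    rw [Set.image_image]
    simp [mul_assoc]
  inv_mem' := by
    intro a ha
    simp only [Set.mem_ofPred_eq] at ha ⊢
    conv_lhs => rw [← ha]
    rw [Set.image_image]
    simp [mul_assoc]

theorem inv_conj_mem {a : (Module.End ℂ S)ˣ} (ha : a ∈ lpin ρ) {x : Module.End ℂ S}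
    (hx : x ∈ vectors ρ) :
    ((a⁻¹ : (Module.End ℂ S)ˣ) : Module.End ℂ S) * x * (a : Module.End ℂ S) ∈ vectors ρ := by
  have h : (fun x => ((a⁻¹ : (Module.End ℂ S)ˣ) : Module.End ℂ S) * x *
      (((a⁻¹)⁻¹ : (Module.End ℂ S)ˣ) : Module.End ℂ S)) '' vectors ρ = vectors ρ :=
    (lpin ρ).inv_mem ha
  rw [inv_inv] at h
  rw [← h]
  exact ⟨x, hx, rfl⟩

/-- `A(h)`: the space of all endomorphisms of `S` that anticommute with every vector. -/
def anti : Submodule ℂ (Module.End ℂ S) where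
  carrier := {w | ∀ v : V, w * ρ (ι Q v) + ρ (ι Q v) * w = 0}
  zero_mem' := by simp
  add_mem' := by
    intro w w' h h' v
    have := congrArg₂ (· + ·) (h v) (h' v)
    simp only [add_zero] at this
    rw [← this, add_mul, mul_add]
    abel
  smul_mem' := by
    intro c w h v
    rw [smul_mul_assoc, mul_smul_comm, ← smul_add, h v, smul_zero]

theorem mem_anti_iff {w : Module.End ℂ S} :
    w ∈ anti ρ ↔ ∀ x ∈ vectors ρ, w * x + x * w = 0 := by
  simp [anti, vectors]

/-- The quadratic form `h₀` on `A(h)`, determined by `w ^ 2 = h₀(w) id`; it is written as the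
normalised trace of `w ^ 2`. -/
def antiForm : QuadraticForm ℂ (anti ρ) :=
  LinearMap.BilinMap.toQuadraticMap
    (((Module.finrank ℂ S : ℂ)⁻¹ • ((LinearMap.mul ℂ (Module.End ℂ S)).compr₂
      (LinearMap.trace ℂ S))).domRestrict₁₂ (anti ρ) (anti ρ))

theorem antiForm_apply (w : anti ρ) :
    antiForm ρ w = (Module.finrank ℂ S : ℂ)⁻¹ *
      LinearMap.trace ℂ S ((w : Module.End ℂ S) * (w : Module.End ℂ S)) := by
  simp only [antiForm, LinearMap.BilinMap.toQuadraticMap_apply]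
  rfl

/-- Conjugation by a unit, as a linear automorphism of `End S`. -/
def conjEnd (a : (Module.End ℂ S)ˣ) : Module.End ℂ S →ₗ[ℂ] Module.End ℂ S where
  toFun w := (a : Module.End ℂ S) * w * ((a⁻¹ : (Module.End ℂ S)ˣ) : Module.End ℂ S)
  map_add' := by intro x y; rw [mul_add, add_mul]
  map_smul' := by intro c x; simp

theorem conjEnd_mem {a : (Module.End ℂ S)ˣ} (ha : a ∈ lpin ρ) {w : Module.End ℂ S}
    (hw : w ∈ anti ρ) : conjEnd a w ∈ anti ρ := by
  rw [mem_anti_iff] at hw ⊢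
  intro x hx
  have h := hw _ (inv_conj_mem ρ ha hx)
  have h' := congrArg (fun y => (a : Module.End ℂ S) * y *
    ((a⁻¹ : (Module.End ℂ S)ˣ) : Module.End ℂ S)) h
  simp only [mul_add, add_mul, mul_zero, zero_mul] at h'
  simpa [conjEnd, mul_assoc] using h'

/-- `κ(a) w = a w a⁻¹` for `a ∈ Lpin(h)` and `w ∈ A(h)`, as a linear automorphism of `A(h)`. -/
def kappaLin (a : lpin ρ) : anti ρ ≃ₗ[ℂ] anti ρ :=
  LinearEquiv.ofLinearMap
    ((conjEnd (a : (Module.End ℂ S)ˣ)).restrict fun _ hw => conjEnd_mem ρ a.2 hw)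
    ((conjEnd ((a⁻¹ : lpin ρ) : (Module.End ℂ S)ˣ)).restrict
      fun _ hw => conjEnd_mem ρ (a⁻¹).2 hw)
    (by ext w : 2; simp [conjEnd, mul_assoc])
    (by ext w : 2; simp [conjEnd, mul_assoc])

theorem kappaLin_apply (a : lpin ρ) (w : anti ρ) :
    (kappaLin ρ a w : Module.End ℂ S) = ((a : (Module.End ℂ S)ˣ) : Module.End ℂ S) * w *
      (((a : (Module.End ℂ S)ˣ)⁻¹ : (Module.End ℂ S)ˣ) : Module.End ℂ S) := rfl

/-- The homomorphism `κ : Lpin(h) → O(h₀, ℂ)`, `κ(a) w = a w a⁻¹`. -/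
def kappa : lpin ρ →* orthogonalGroup (antiForm ρ) where
  toFun a := ⟨kappaLin ρ a, fun w => by
    rw [antiForm_apply, antiForm_apply, kappaLin_apply]
    congr 1
    rw [LinearMap.trace_mul_comm]
    simp only [mul_assoc, Units.inv_mul_cancel_left]
    rw [LinearMap.trace_mul_comm]
    simp [mul_assoc]⟩
  map_one' := by
    apply Subtype.ext
    ext w : 2
    simp [kappaLin_apply]
  map_mul' a b := by
    apply Subtype.ext
    ext w : 2
    simp [kappaLin_apply, mul_assoc]

end Spinor

end

end Lipschitz

open Lipschitz

/-! Vectors square to real scalars, so conjugation by an element `a` of the Lipschitz group is an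
isometry of V. By the Cartan–Dieudonné theorem (`isTwistedConj_of_isometry`) that isometry has the
form `v ↦ α(b) v b⁻¹` with `b` in Pin. Once `b` is made to act on S so that it induces the same
isometry by plain conjugation, it differs from `a` only by an invertible element of the commutant of
V, which Schur's lemma computes. Lpin is thus assembled from Pin and the commutant, and κ can be
read off on each factor.

For even m the volume element η is even and anticommutes with V. It absorbs the sign between twisted
and plain conjugation, the commutant is ℂ, and A(h) is the line spanned by η. Hence every `a` is `c
b` with `b` in Pin, κ(a) is the parity of `b`, and a vector rescaled to have square 1 gives the
splitting.

For odd m the element η is odd and central, and acts on S₀ ⊕ S₀ as diag(z, -z). The commutant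
therefore consists of the scalar block matrices diag(λ, μ), and A(h) of the antidiagonal ones, a
hyperbolic plane with form xy. Multiplying each odd `b` by an antidiagonal J with J² = -1 gives a
representation of Pin whose plain conjugation is the twisted one. On the product of diag(λ, μ) with
this image of `b`, κ is the pair formed by λ/μ and the parity of `b`; all kernels follow from this
formula.

Injectivity up to sign comes from one fact about the Clifford algebra: an even element commuting
with V is a real scalar (`mem_span_one_of_central_even`), and the only real scalars in Pin are ±1.
-/

namespace Lipschitz

/-! ### Orthonormal bases and contractions in the Clifford algebra. -/

section Clifford

variable {V : Type*} [AddCommGroup V] [Module ℝ V] {Q : QuadraticForm ℝ V}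

/-- An orthogonal basis consisting of vectors on which the form is `1` or `-1`. -/
structure IsOrthonormalBasis {n : Type*} (Q : QuadraticForm ℝ V) (e : Module.Basis n ℝ V) :
    Prop where
  unit : ∀ i, Q (e i) = 1 ∨ Q (e i) = -1
  ortho : ∀ i j, i ≠ j → QuadraticMap.polar Q (e i) (e j) = 0

theorem exists_isOrthonormalBasis [FiniteDimensional ℝ V] (hQ : Q.Nondegenerate) :
    ∃ e : Module.Basis (Fin (Module.finrank ℝ V)) ℝ V, IsOrthonormalBasis Q e := by
  obtain ⟨w, hw, ⟨f⟩⟩ := QuadraticForm.equivalent_one_neg_one_weighted_sum_squared Q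
    (QuadraticMap.nondegenerate_associated_iff.2 hQ).1
  have hsingle : ∀ i, QuadraticMap.weightedSumSquares ℝ w (Pi.single i 1) = w i := by
    intro i
    rw [QuadraticMap.weightedSumSquares_apply, Finset.sum_eq_single i] <;>
      simp +contextual
  refine ⟨(Pi.basisFun ℝ _).map f.toLinearEquiv.symm, ⟨fun i => ?_, fun i j hij => ?_⟩⟩
  · have h : Q (f.symm (Pi.single i 1)) = w i := by rw [f.symm.map_app, hsingle]
    have h' : Q (((Pi.basisFun ℝ _).map f.toLinearEquiv.symm) i) = w i := by
      simpa using h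
    rw [h']
    exact (hw i).symm
  · have h : ∀ x y, QuadraticMap.polar Q (f.toLinearEquiv.symm x) (f.toLinearEquiv.symm y) =
        QuadraticMap.polar (QuadraticMap.weightedSumSquares ℝ w) x y := by
      intro x y
      have h1 : ∀ z, Q (f.toLinearEquiv.symm z) = QuadraticMap.weightedSumSquares ℝ w z :=
        fun z => f.symm.map_app z
      simp only [QuadraticMap.polar, ← map_add, h1]
    simp only [Module.Basis.map_apply, Pi.basisFun_apply, h]
    rw [QuadraticMap.polar, hsingle, hsingle, QuadraticMap.weightedSumSquares_apply,
      Finset.sum_eq_add_of_mem i j (Finset.mem_univ _) (Finset.mem_univ _) hij]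
    · simp [hij, hij.symm]
    · intro k _ hk
      simp [hk.1, hk.2]

theorem ι_mul_ι_of_unit {v : V} (hv : Q v = 1 ∨ Q v = -1) :
    ι Q v * ι Q v = 1 ∨ ι Q v * ι Q v = -1 := by
  rw [ι_sq_scalar]
  rcases hv with h | h <;> simp [h]

theorem exists_mem_pin_eq_ι {v : V} (hv : Q v = 1 ∨ Q v = -1) :
    ∃ u ∈ pin Q, (u : CliffordAlgebra Q) = ι Q v := by
  have h2 : Q v * Q v = 1 := by rcases hv with h | h <;> simp [h]
  have h3 : ι Q v * (Q v • ι Q v) = 1 := by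
    rw [mul_smul_comm, ι_sq_scalar, Algebra.smul_def, ← map_mul, h2, map_one]
  have h4 : (Q v • ι Q v) * ι Q v = 1 := by
    rw [smul_mul_assoc, ι_sq_scalar, Algebra.smul_def, ← map_mul, h2, map_one]
  exact ⟨⟨ι Q v, Q v • ι Q v, h3, h4⟩, Subgroup.subset_closure ⟨v, rfl, hv⟩, rfl⟩

/-- The twisted commutator with a vector and the contraction are both antiderivations agreeing on
generators. This turns commutation questions into the vanishing of contractions. -/
theorem ι_mul_sub_involute_mul_ι (v : V) (x : CliffordAlgebra Q) :
    ι Q v * x - involute x * ι Q v = contractLeft (QuadraticMap.polarBilin Q v) x := by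
  induction x using CliffordAlgebra.left_induction with
  | algebraMap r => rw [contractLeft_algebraMap, AlgHom.commutes, Algebra.commutes, sub_self]
  | add x y hx hy => rw [map_add, map_add, ← hx, ← hy, mul_add, add_mul]; abel
  | ι_mul x w hx =>
    rw [contractLeft_ι_mul, ← hx, map_mul, involute_ι, QuadraticMap.polarBilin_apply_apply,
      Algebra.smul_def, ← ι_mul_ι_add_swap]
    noncomm_ring

/-! ### Monomials in an orthonormal basis, even central elements, the volume element. -/

section Basis

variable {n : Type*} {e : Module.Basis n ℝ V}

/-- The span of the ordered products of basis vectors with indices in a list. -/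
noncomputable def monomialSpan (Q : QuadraticForm ℝ V) (e : Module.Basis n ℝ V) :
    List n → Submodule ℝ (CliffordAlgebra Q)
  | [] => Submodule.span ℝ {1}
  | j :: l => monomialSpan Q e l ⊔
      (monomialSpan Q e l).map (LinearMap.mulLeft ℝ (ι Q (e j)))

theorem mem_monomialSpan_cons {j : n} {l : List n} {x : CliffordAlgebra Q} :
    x ∈ monomialSpan Q e (j :: l) ↔
      ∃ y ∈ monomialSpan Q e l, ∃ z ∈ monomialSpan Q e l, y + ι Q (e j) * z = x := by
  simp [monomialSpan, Submodule.mem_sup]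

theorem one_mem_monomialSpan (l : List n) : (1 : CliffordAlgebra Q) ∈ monomialSpan Q e l := by
  induction l with
  | nil => exact Submodule.subset_span rfl
  | cons j l ih => exact Submodule.mem_sup_left ih

theorem ι_mul_ι_of_ne (he : IsOrthonormalBasis Q e) {i j : n} (h : i ≠ j) :
    ι Q (e i) * ι Q (e j) = -(ι Q (e j) * ι Q (e i)) := by
  rw [eq_neg_iff_add_eq_zero, ι_mul_ι_add_swap, he.ortho i j h, map_zero]

theorem ι_mul_mem_monomialSpan (he : IsOrthonormalBasis Q e) {l : List n} {i : n} (hi : i ∈ l)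
    {x : CliffordAlgebra Q} (hx : x ∈ monomialSpan Q e l) :
    ι Q (e i) * x ∈ monomialSpan Q e l := by
  induction l generalizing x with
  | nil => simp at hi
  | cons j l ih =>
    obtain ⟨y, hy, z, hz, rfl⟩ := mem_monomialSpan_cons.1 hx
    rw [mem_monomialSpan_cons]
    by_cases h : i = j
    · subst h
      refine ⟨Q (e i) • z, Submodule.smul_mem _ _ hz, y, hy, ?_⟩
      rw [mul_add, ← mul_assoc, ι_sq_scalar, Algebra.smul_def, add_comm]
    · have hi' : i ∈ l := by simpa [h] using hi
      refine ⟨_, ih hi' hy, -(ι Q (e i) * z), neg_mem (ih hi' hz), ?_⟩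
      rw [mul_add, ← mul_assoc, ι_mul_ι_of_ne he h]
      noncomm_ring

theorem contractLeft_monomialSpan (he : IsOrthonormalBasis Q e) {l : List n} {j : n}
    (hj : j ∉ l) {x : CliffordAlgebra Q} (hx : x ∈ monomialSpan Q e l) :
    contractLeft (QuadraticMap.polarBilin Q (e j)) x = 0 := by
  induction l generalizing x with
  | nil =>
    obtain ⟨c, rfl⟩ := Submodule.mem_span_singleton.1 hx
    rw [map_smul, contractLeft_one, smul_zero]
  | cons k l ih =>
    obtain ⟨y, hy, z, hz, rfl⟩ := mem_monomialSpan_cons.1 hx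
    rw [List.mem_cons, not_or] at hj
    rw [map_add, contractLeft_ι_mul, ih hj.2 hy, ih hj.2 hz,
      QuadraticMap.polarBilin_apply_apply, he.ortho j k hj.1]
    simp

/-- Write x = y + e_j z with y and z free of e_j. Contraction with e_j kills y and z and leaves 2
Q(e_j) z, so z = 0; the indices are peeled off one by one until only scalars remain. -/
theorem mem_span_one_of_contractLeft_eq_zero (he : IsOrthonormalBasis Q e) {l : List n}
    (hl : l.Nodup) {x : CliffordAlgebra Q} (hx : x ∈ monomialSpan Q e l)
    (hd : ∀ j, contractLeft (QuadraticMap.polarBilin Q (e j)) x = 0) :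
    x ∈ Submodule.span ℝ {(1 : CliffordAlgebra Q)} := by
  induction l generalizing x with
  | nil => exact hx
  | cons j l ih =>
    obtain ⟨y, hy, z, hz, rfl⟩ := mem_monomialSpan_cons.1 hx
    rw [List.nodup_cons] at hl
    have h := hd j
    rw [map_add, contractLeft_ι_mul, contractLeft_monomialSpan he hl.1 hy,
      contractLeft_monomialSpan he hl.1 hz, QuadraticMap.polarBilin_apply_apply,
      QuadraticMap.polar_self] at h
    have hne : Q (e j) ≠ 0 := by
      rcases he.unit j with h | h <;> simp [h]
    have hz0 : z = 0 := by simpa [hne] using h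
    rw [hz0, mul_zero, add_zero] at hd hx ⊢
    exact ih hl.2 hy hd

theorem mem_monomialSpan_univ [Fintype n] (he : IsOrthonormalBasis Q e)
    (x : CliffordAlgebra Q) : x ∈ monomialSpan Q e Finset.univ.toList := by
  induction x using CliffordAlgebra.left_induction with
  | algebraMap r =>
    rw [Algebra.algebraMap_eq_smul_one]
    exact Submodule.smul_mem _ _ (one_mem_monomialSpan _)
  | add x y hx hy => exact add_mem hx hy
  | ι_mul x w hx =>
    rw [← e.sum_repr w, map_sum, Finset.sum_mul]
    refine Submodule.sum_mem _ fun i _ => ?_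
    rw [map_smul, smul_mul_assoc]
    exact Submodule.smul_mem _ _ (ι_mul_mem_monomialSpan he (by simp) hx)

/-- For an even element the commutator with a vector is the twisted commutator, so centrality makes
every contraction vanish. -/
theorem mem_span_one_of_central_even [FiniteDimensional ℝ V] (hQ : Q.Nondegenerate)
    {x : CliffordAlgebra Q} (hx : involute x = x) (hc : ∀ v, ι Q v * x = x * ι Q v) :
    x ∈ Submodule.span ℝ {(1 : CliffordAlgebra Q)} := by
  obtain ⟨e, he⟩ := exists_isOrthonormalBasis hQ
  refine mem_span_one_of_contractLeft_eq_zero he Finset.univ.nodup_toList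
    (mem_monomialSpan_univ he x) fun j => ?_
  rw [← ι_mul_sub_involute_mul_ι, hx, hc, sub_self]

/-- The product of the basis vectors with indices in `s`, up to order. -/
theorem exists_mem_pin_prod [DecidableEq n] (he : IsOrthonormalBasis Q e) (s : Finset n) :
    ∃ b ∈ pin Q, involute (b : CliffordAlgebra Q) = (-1) ^ s.card * (b : CliffordAlgebra Q) ∧
      ∀ i, involute (b : CliffordAlgebra Q) * ι Q (e i) =
        (if i ∈ s then -ι Q (e i) else ι Q (e i)) * b := by
  induction s using Finset.induction_on with
  | empty => exact ⟨1, one_mem _, by simp, by simp⟩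
  | insert j s hj ih =>
    obtain ⟨b, hb, h1, h2⟩ := ih
    obtain ⟨u, hu, hu'⟩ := exists_mem_pin_eq_ι (he.unit j)
    have key : involute ((u * b : (CliffordAlgebra Q)ˣ) : CliffordAlgebra Q) =
        -(ι Q (e j) * involute (b : CliffordAlgebra Q)) := by
      rw [Units.val_mul, map_mul, hu', involute_ι, neg_mul]
    refine ⟨u * b, mul_mem hu hb, ?_, fun i => ?_⟩
    · rw [key, h1, Finset.card_insert_of_notMem hj, Units.val_mul, hu']
      rcases neg_one_pow_eq_or (CliffordAlgebra Q) s.card with h | h <;> simp [pow_succ, h]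
    · rw [key, neg_mul, mul_assoc, h2, Units.val_mul, hu']
      by_cases hij : i = j
      · subst hij
        simp [hj]
      · by_cases his : i ∈ s <;>
          simp [hij, his, ← mul_assoc, ι_mul_ι_of_ne he (Ne.symm hij)]

/-- The product of all basis vectors realises -id as a twisted conjugation. Its parity is that of m,
so it anticommutes with vectors for m even and commutes with them for m odd. -/
theorem exists_volume [FiniteDimensional ℝ V] (hQ : Q.Nondegenerate) :
    ∃ b ∈ pin Q,
      involute (b : CliffordAlgebra Q) =
        (-1) ^ Module.finrank ℝ V * (b : CliffordAlgebra Q) ∧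
      ∀ v, involute (b : CliffordAlgebra Q) * ι Q v = -(ι Q v * b) := by
  obtain ⟨e, he⟩ := exists_isOrthonormalBasis hQ
  obtain ⟨b, hb, h1, h2⟩ := exists_mem_pin_prod he Finset.univ
  refine ⟨b, hb, by simpa using h1, fun v => ?_⟩
  have : (LinearMap.mulLeft ℝ (involute (b : CliffordAlgebra Q))).comp (ι Q) =
      -(LinearMap.mulRight ℝ (b : CliffordAlgebra Q)).comp (ι Q) :=
    e.ext fun i => by simpa using h2 i
  exact LinearMap.congr_fun this v

end Basis

/-! ### Spinor norm and the action of Pin on vectors. -/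

theorem reverse_of_mem_pin {b : (CliffordAlgebra Q)ˣ} (hb : b ∈ pin Q) :
    ∃ ε : ℝ, (ε = 1 ∨ ε = -1) ∧
      reverse (b : CliffordAlgebra Q) = ε • ((b⁻¹ : (CliffordAlgebra Q)ˣ) : CliffordAlgebra Q) := by
  induction hb using Subgroup.closure_induction with
  | mem u hu =>
    obtain ⟨v, hv, h⟩ := hu
    refine ⟨Q v, h, ?_⟩
    rw [hv, reverse_ι, ← Units.mul_right_inj u, mul_smul_comm, Units.mul_inv, hv, ι_sq_scalar,
      Algebra.algebraMap_eq_smul_one]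
  | one => exact ⟨1, Or.inl rfl, by simp⟩
  | mul x y _ _ hx hy =>
    obtain ⟨ε, h, hx⟩ := hx
    obtain ⟨δ, h', hy⟩ := hy
    refine ⟨ε * δ, ?_, ?_⟩
    · rcases h with h | h <;> rcases h' with h' | h' <;> simp [h, h']
    · rw [Units.val_mul, reverse.map_mul, hx, hy, mul_inv_rev, Units.val_mul, smul_mul_smul_comm,
        mul_comm δ]
  | inv x _ hx =>
    obtain ⟨ε, h, hx⟩ := hx
    refine ⟨ε, h, ?_⟩
    have h2 : ε * ε = 1 := by rcases h with h | h <;> simp [h]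
    have h1 : reverse ((x⁻¹ : (CliffordAlgebra Q)ˣ) : CliffordAlgebra Q) *
        reverse (x : CliffordAlgebra Q) = 1 := by
      rw [← reverse.map_mul, Units.mul_inv, reverse.map_one]
    rw [hx, mul_smul_comm] at h1
    rw [inv_inv, ← Units.mul_left_inj x⁻¹, smul_mul_assoc, Units.mul_inv, ← h1, smul_smul, h2,
      one_smul]

/-- Reversal fixes vectors, so on Pin it agrees with inversion up to sign and b times its reverse is
±1. For a real scalar r this says r² = ±1, and r² = -1 is impossible. -/
theorem eq_one_or_neg_one_of_mem_pin {b : (CliffordAlgebra Q)ˣ} (hb : b ∈ pin Q)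
    (h : (b : CliffordAlgebra Q) ∈ Submodule.span ℝ {(1 : CliffordAlgebra Q)}) :
    b = 1 ∨ b = -1 := by
  obtain ⟨r, hr⟩ := Submodule.mem_span_singleton.1 h
  obtain ⟨ε, hε, h1⟩ := reverse_of_mem_pin hb
  have h2 : (b : CliffordAlgebra Q) * reverse (b : CliffordAlgebra Q) = ε • 1 := by
    rw [h1, mul_smul_comm, Units.mul_inv]
  rw [← hr, map_smul, reverse.map_one, smul_mul_smul_comm, mul_one] at h2
  have h3 : r * r = ε := by
    have := smul_left_injective ℝ (one_ne_zero (α := CliffordAlgebra Q)) h2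
    exact this
  have h4 : r = 1 ∨ r = -1 := by
    rcases hε with h | h
    · exact mul_self_eq_one_iff.1 (h3.trans h)
    · nlinarith [mul_self_nonneg r]
  rcases h4 with h | h
  · left; ext; rw [← hr, h, one_smul]; rfl
  · right; ext; rw [← hr, h]; simp

/-- For a unit vector v, conjugation of x gives a multiple of v minus x. The two halves are
exchanged by inversion, so they have to be proved in the same induction. -/
theorem conj_ι_of_mem_pin {b : (CliffordAlgebra Q)ˣ} (hb : b ∈ pin Q) :
    (∀ v, ∃ w, (b : CliffordAlgebra Q) * ι Q v = ι Q w * b) ∧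
      ∀ v, ∃ w, ι Q v * (b : CliffordAlgebra Q) = b * ι Q w := by
  induction hb using Subgroup.closure_induction with
  | mem u hu =>
    obtain ⟨v, hv, h⟩ := hu
    rw [hv]
    have h2 : Q v * Q v = 1 := by rcases h with h | h <;> simp [h]
    have key : ∀ x, ι Q v * ι Q x + ι Q x * ι Q v =
        (QuadraticMap.polar Q v x * Q v) • (ι Q v * ι Q v) := by
      intro x
      rw [ι_mul_ι_add_swap, ι_sq_scalar, Algebra.algebraMap_eq_smul_one,
        Algebra.algebraMap_eq_smul_one, smul_smul, mul_assoc, h2, mul_one]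
    refine ⟨fun x => ⟨(QuadraticMap.polar Q v x * Q v) • v - x, ?_⟩,
      fun x => ⟨(QuadraticMap.polar Q v x * Q v) • v - x, ?_⟩⟩
    · rw [map_sub, map_smul, sub_mul, smul_mul_assoc, ← key]; abel
    · rw [map_sub, map_smul, mul_sub, mul_smul_comm, ← key]; abel
  | one => exact ⟨fun v => ⟨v, by simp⟩, fun v => ⟨v, by simp⟩⟩
  | mul x y _ _ hx hy =>
    refine ⟨fun v => ?_, fun v => ?_⟩
    · obtain ⟨w, hw⟩ := hy.1 v
      obtain ⟨w', hw'⟩ := hx.1 w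
      exact ⟨w', by rw [Units.val_mul, mul_assoc, hw, ← mul_assoc, hw', mul_assoc]⟩
    · obtain ⟨w, hw⟩ := hx.2 v
      obtain ⟨w', hw'⟩ := hy.2 w
      exact ⟨w', by rw [Units.val_mul, ← mul_assoc, hw, mul_assoc, hw', mul_assoc]⟩
  | inv x _ hx =>
    refine ⟨fun v => ?_, fun v => ?_⟩
    · obtain ⟨w, hw⟩ := hx.2 v
      exact ⟨w, by rw [Units.inv_mul_eq_iff_eq_mul, ← mul_assoc, ← hw, mul_assoc, Units.mul_inv,
        mul_one]⟩
    · obtain ⟨w, hw⟩ := hx.1 v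
      exact ⟨w, by rw [← Units.inv_mul_eq_iff_eq_mul, inv_inv, ← mul_assoc, hw, mul_assoc,
        Units.mul_inv, mul_one]⟩

/-! ### Reflections and the Cartan–Dieudonné theorem. -/

/-- The linear map `T` is the twisted conjugation by an element of the Pin group. -/
def IsTwistedConj (Q : QuadraticForm ℝ V) (T : V →ₗ[ℝ] V) : Prop :=
  ∃ b ∈ pin Q, ∀ x, involute (b : CliffordAlgebra Q) * ι Q x = ι Q (T x) * b

theorem IsTwistedConj.comp {T T' : V →ₗ[ℝ] V} (h : IsTwistedConj Q T)
    (h' : IsTwistedConj Q T') : IsTwistedConj Q (T ∘ₗ T') := by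
  obtain ⟨b, hb, h⟩ := h
  obtain ⟨b', hb', h'⟩ := h'
  refine ⟨b * b', mul_mem hb hb', fun x => ?_⟩
  rw [Units.val_mul, map_mul, mul_assoc, h', ← mul_assoc, h, LinearMap.comp_apply, mul_assoc]

/-- The reflection in a vector. -/
noncomputable def reflect (Q : QuadraticForm ℝ V) (u : V) : V →ₗ[ℝ] V :=
  LinearMap.id - (Q u)⁻¹ • (QuadraticMap.polarBilin Q u).smulRight u

theorem reflect_apply (u x : V) :
    reflect Q u x = x - ((Q u)⁻¹ * QuadraticMap.polar Q u x) • u := by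
  simp [reflect, smul_smul]

theorem isTwistedConj_reflect {u : V} (hu : Q u ≠ 0) : IsTwistedConj Q (reflect Q u) := by
  have hpos : 0 < |Q u| := abs_pos.2 hu
  have hs : Real.sqrt |Q u| ≠ 0 := (Real.sqrt_pos.2 hpos).ne'
  -- Rescaling u to a unit vector leaves the reflection unchanged and puts the vector in Pin.
  set c := (Real.sqrt |Q u|)⁻¹ with hc
  have hc0 : c ≠ 0 := inv_ne_zero hs
  have hcc : c * c = |Q u|⁻¹ := by
    rw [hc, ← mul_inv, Real.mul_self_sqrt (abs_nonneg _)]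
  have h1 : Q (c • u) = 1 ∨ Q (c • u) = -1 := by
    rw [QuadraticMap.map_smul, hcc, smul_eq_mul]
    rcases abs_choice (Q u) with h | h
    · left; rw [h]; field_simp
    · right; rw [h]; field_simp
  obtain ⟨b, hb, hb'⟩ := exists_mem_pin_eq_ι h1
  refine ⟨b, hb, fun x => ?_⟩
  have key : ι Q u * ι Q x + ι Q x * ι Q u =
      ((Q u)⁻¹ * QuadraticMap.polar Q u x) • (ι Q u * ι Q u) := by
    rw [ι_mul_ι_add_swap, ι_sq_scalar, Algebra.algebraMap_eq_smul_one,
      Algebra.algebraMap_eq_smul_one, smul_smul]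
    congr 1
    field_simp
  rw [hb', involute_ι, reflect_apply, map_smul, map_sub, map_smul, neg_mul, smul_mul_assoc,
    mul_smul_comm, sub_mul, smul_mul_assoc, ← key, ← smul_neg]
  congr 1
  abel

theorem reflect_reflect {u : V} (hu : Q u ≠ 0) : reflect Q u ∘ₗ reflect Q u = LinearMap.id := by
  ext x
  simp only [LinearMap.comp_apply, reflect_apply, LinearMap.id_apply, QuadraticMap.polar_sub_right,
    QuadraticMap.polar_smul_right, QuadraticMap.polar_self, smul_eq_mul]
  match_scalars <;> field_simp
  ring

theorem map_reflect {u : V} (hu : Q u ≠ 0) (x : V) : Q (reflect Q u x) = Q x := by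
  rw [reflect_apply, sub_eq_add_neg, ← neg_smul, QuadraticMap.map_add Q, QuadraticMap.map_smul,
    QuadraticMap.polar_smul_right, QuadraticMap.polar_comm Q x u]
  simp only [smul_eq_mul]
  field_simp
  ring

theorem IsTwistedConj.of_reflect_comp {u : V} (hu : Q u ≠ 0) {T : V →ₗ[ℝ] V}
    (h : IsTwistedConj Q (reflect Q u ∘ₗ T)) : IsTwistedConj Q T := by
  have := (isTwistedConj_reflect hu).comp h
  rwa [← LinearMap.comp_assoc, reflect_reflect hu, LinearMap.id_comp] at this

theorem polar_map {T : V →ₗ[ℝ] V} (hT : ∀ x, Q (T x) = Q x) (x y : V) :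
    QuadraticMap.polar Q (T x) (T y) = QuadraticMap.polar Q x y := by
  simp only [QuadraticMap.polar, ← map_add, hT]

/-- Induction on the set of basis vectors that T may move. At most two reflections carry T e_j back
to e_j, and their vectors are orthogonal to the basis vectors already fixed, which therefore stay
fixed. -/
theorem isTwistedConj_of_fixed {n : Type*} [DecidableEq n] {e : Module.Basis n ℝ V}
    (he : IsOrthonormalBasis Q e) (s : Finset n) (T : V →ₗ[ℝ] V) (hT : ∀ x, Q (T x) = Q x)
    (hs : ∀ i ∉ s, T (e i) = e i) : IsTwistedConj Q T := by
  induction s using Finset.induction_on generalizing T with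
  | empty =>
    have : T = LinearMap.id := e.ext fun i => hs i (by simp)
    exact ⟨1, one_mem _, by simp [this]⟩
  | insert j s hj ih =>
    have hq : Q (e j) ≠ 0 := by rcases he.unit j with h | h <;> simp [h]
    have hfix : ∀ i ∉ s, i ≠ j → T (e i) = e i := fun i hi hij => hs i (by simp [hi, hij])
    have hort : ∀ i ∉ s, i ≠ j → QuadraticMap.polar Q (T (e j)) (e i) = 0 := fun i hi hij => by
      rw [← hfix i hi hij, polar_map hT, he.ortho j i hij.symm]
    have hpol : QuadraticMap.polar Q (T (e j)) (T (e j)) = 2 * Q (e j) := by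
      rw [QuadraticMap.polar_self, hT, nsmul_eq_mul, Nat.cast_ofNat]
    have hee : QuadraticMap.polar Q (e j) (e j) = 2 * Q (e j) := by
      rw [QuadraticMap.polar_self, nsmul_eq_mul, Nat.cast_ofNat]
    set p := QuadraticMap.polar Q (T (e j)) (e j) with hp
    have hp' : QuadraticMap.polar Q (e j) (T (e j)) = p := QuadraticMap.polar_comm Q _ _
    have hsub : Q (T (e j) - e j) = 2 * Q (e j) - p := by
      rw [sub_eq_add_neg, QuadraticMap.map_add Q, QuadraticMap.polar_neg_right,
        QuadraticMap.map_neg, hT]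
      ring
    have hadd : Q (T (e j) + e j) = 2 * Q (e j) + p := by
      rw [QuadraticMap.map_add Q, hT]
      ring
    -- Since Q(T e_j - e_j) + Q(T e_j + e_j) = 4 Q(e_j), the difference and the sum are not both
    -- isotropic. Reflection in the difference sends T e_j to e_j; reflection in the sum sends it to
    -- -e_j, which reflection in e_j then corrects.
    by_cases h : Q (T (e j) - e j) = 0
    · have hp2 : p = 2 * Q (e j) := by linarith
      have h' : Q (T (e j) + e j) ≠ 0 := by
        rw [hadd, hp2]
        intro h0
        exact hq (by linarith)
      have hne : Q (e j) + Q (e j) ≠ 0 := by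
        intro h0
        exact hq (by linarith)
      refine IsTwistedConj.of_reflect_comp h' (IsTwistedConj.of_reflect_comp hq (ih _ ?_ ?_))
      · intro x
        rw [LinearMap.comp_apply, map_reflect hq, LinearMap.comp_apply, map_reflect h', hT]
      · intro i hi
        simp only [LinearMap.comp_apply]
        by_cases hij : i = j
        · subst hij
          have h1 : reflect Q (T (e i) + e i) (T (e i)) = -e i := by
            rw [reflect_apply, QuadraticMap.polar_add_left, hpol, hp', hadd, inv_mul_cancel₀
              (hadd ▸ h'), one_smul]
            abel
          rw [h1, reflect_apply, QuadraticMap.polar_neg_right, hee]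
          match_scalars
          field_simp
          ring
        · rw [hfix i hi hij, reflect_apply (T (e j) + e j), QuadraticMap.polar_add_left,
            hort i hi hij, he.ortho j i (Ne.symm hij), add_zero, mul_zero, zero_smul, sub_zero,
            reflect_apply, he.ortho j i (Ne.symm hij), mul_zero, zero_smul, sub_zero]
    · refine IsTwistedConj.of_reflect_comp h (ih _ ?_ ?_)
      · intro x
        rw [LinearMap.comp_apply, map_reflect h, hT]
      · intro i hi
        simp only [LinearMap.comp_apply]
        by_cases hij : i = j
        · subst hij
          rw [reflect_apply, QuadraticMap.polar_sub_left, hpol, hp', hsub, inv_mul_cancel₀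
            (hsub ▸ h), one_smul]
          abel
        · rw [hfix i hi hij, reflect_apply, QuadraticMap.polar_sub_left,
            hort i hi hij, he.ortho j i (Ne.symm hij), sub_zero, mul_zero, zero_smul, sub_zero]

/-- Every isometry is a twisted conjugation by an element of the Pin group. -/
theorem isTwistedConj_of_isometry [FiniteDimensional ℝ V] (hQ : Q.Nondegenerate)
    (T : V →ₗ[ℝ] V) (hT : ∀ x, Q (T x) = Q x) : IsTwistedConj Q T := by
  obtain ⟨e, he⟩ := exists_isOrthonormalBasis hQ
  exact isTwistedConj_of_fixed he Finset.univ T hT (by simp)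

end Clifford

/-- Schur's lemma for a set of endomorphisms without common invariant subspaces. -/
theorem exists_eq_smul_one_of_commute {S : Type*} [AddCommGroup S] [Module ℂ S]
    [FiniteDimensional ℂ S] [Nontrivial S] (A : Set (Module.End ℂ S))
    (hA : ∀ W : Submodule ℂ S, (∀ a ∈ A, ∀ s ∈ W, a s ∈ W) → W = ⊥ ∨ W = ⊤)
    (f : Module.End ℂ S) (hf : ∀ a ∈ A, f * a = a * f) : ∃ c : ℂ, f = c • 1 := by
  obtain ⟨c, hc⟩ := Module.End.exists_eigenvalue f
  have hinv : ∀ a ∈ A, ∀ s ∈ f.eigenspace c, a s ∈ f.eigenspace c := fun a ha s hs => by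
    rw [Module.End.mem_eigenspace_iff] at hs ⊢
    rw [← Module.End.mul_apply, hf a ha, Module.End.mul_apply, hs, map_smul]
  refine ⟨c, ?_⟩
  rcases hA _ hinv with h | h
  · exact absurd h hc
  · ext s
    have hs : s ∈ f.eigenspace c := h ▸ Submodule.mem_top
    simpa using Module.End.mem_eigenspace_iff.1 hs

/-- The homomorphism from `ℤ₂` determined by an involution. -/
def signHom {G : Type*} [Group G] (s : G) (hs : s * s = 1) : ℤˣ →* G where
  toFun ε := if ε = 1 then 1 else s
  map_one' := if_pos rfl
  map_mul' ε δ := by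
    rcases Int.units_eq_one_or ε with rfl | rfl <;>
      rcases Int.units_eq_one_or δ with rfl | rfl <;> simp [hs]

theorem signHom_neg_one {G : Type*} [Group G] (s : G) (hs : s * s = 1) :
    signHom s hs (-1) = s := rfl

/-! ### The Lipschitz group of an arbitrary representation. -/

section Representation

variable {V : Type*} [AddCommGroup V] [Module ℝ V] {Q : QuadraticForm ℝ V}
  {S : Type*} [AddCommGroup S] [Module ℂ S] (ρ : CliffordAlgebra Q →ₐ[ℝ] Module.End ℂ S)

theorem mem_lpin_iff {a : (Module.End ℂ S)ˣ} :
    a ∈ lpin ρ ↔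
      (∀ v, ∃ w, (a : Module.End ℂ S) * ρ (ι Q v) = ρ (ι Q w) * a) ∧
        ∀ v, ∃ w, ρ (ι Q v) * (a : Module.End ℂ S) = a * ρ (ι Q w) := by
  have h1 : ∀ x y : Module.End ℂ S,
      (a : Module.End ℂ S) * x * ((a⁻¹ : (Module.End ℂ S)ˣ) : Module.End ℂ S) = y ↔
        (a : Module.End ℂ S) * x = y * a := fun x y => Units.mul_inv_eq_iff_eq_mul a
  change _ '' vectors ρ = vectors ρ ↔ _
  rw [Set.Subset.antisymm_iff]
  refine and_congr ⟨fun h v => ?_, ?_⟩ ⟨fun h v => ?_, ?_⟩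
  · obtain ⟨w, hw⟩ := h ⟨_, ⟨v, rfl⟩, rfl⟩
    exact ⟨w, (h1 _ _).1 hw.symm⟩
  · rintro h _ ⟨_, ⟨v, rfl⟩, rfl⟩
    obtain ⟨w, hw⟩ := h v
    exact ⟨w, ((h1 _ _).2 hw).symm⟩
  · obtain ⟨_, ⟨w, rfl⟩, hw⟩ := h ⟨v, rfl⟩
    exact ⟨w, ((h1 _ _).1 hw).symm⟩
  · rintro h _ ⟨v, rfl⟩
    obtain ⟨w, hw⟩ := h v
    exact ⟨_, ⟨w, rfl⟩, (h1 _ _).2 hw.symm⟩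

theorem mul_map_of_commute {w : Module.End ℂ S} (hw : ∀ v, w * ρ (ι Q v) = ρ (ι Q v) * w)
    (a : CliffordAlgebra Q) : w * ρ a = ρ a * w := by
  induction a using CliffordAlgebra.induction with
  | algebraMap r => rw [AlgHom.commutes, Algebra.commutes]
  | ι v => exact hw v
  | mul a b ha hb => rw [map_mul, ← mul_assoc, ha, mul_assoc, hb, mul_assoc]
  | add a b ha hb => rw [map_add, mul_add, add_mul, ha, hb]

/-- An element of A(h) intertwines ρ with ρ ∘ α: both sides are multiplicative, so it suffices to
look at vectors. Parity is detected through this relation. -/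
theorem mul_map_of_mem_anti {w : Module.End ℂ S} (hw : w ∈ anti ρ)
    (a : CliffordAlgebra Q) : w * ρ a = ρ (involute a) * w := by
  induction a using CliffordAlgebra.induction with
  | algebraMap r => rw [AlgHom.commutes, AlgHom.commutes, AlgHom.commutes, Algebra.commutes]
  | ι v => rw [involute_ι, map_neg, neg_mul]; exact eq_neg_of_add_eq_zero_left (hw v)
  | mul a b ha hb => rw [map_mul, ← mul_assoc, ha, mul_assoc, hb, map_mul, map_mul, mul_assoc]
  | add a b ha hb => rw [map_add, mul_add, ha, hb, map_add, map_add, add_mul]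

/-- A vector acting as zero is polar-orthogonal to all of V; faithfulness is not needed. -/
theorem map_ι_injective [Nontrivial S] (hQ : Q.Nondegenerate) :
    Function.Injective fun v => ρ (ι Q v) := by
  have h0 : ∀ v, ρ (ι Q v) = 0 → v = 0 := by
    intro v hv
    refine (QuadraticMap.nondegenerate_polar_iff.2 hQ).1 v fun w => ?_
    have h := congrArg ρ (ι_mul_ι_add_swap (Q := Q) v w)
    rw [map_add, map_mul, map_mul, hv, zero_mul, mul_zero, add_zero, AlgHom.commutes] at h
    exact (map_eq_zero_iff _ (algebraMap ℝ (Module.End ℂ S)).injective).1 h.symm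
  intro v w h
  refine sub_eq_zero.1 (h0 _ ?_)
  rw [map_sub, map_sub]
  exact sub_eq_zero.2 h

/-- An element of the Lipschitz group acts on vectors by an isometry. -/
theorem exists_isometry_of_mem_lpin [Nontrivial S] (hQ : Q.Nondegenerate)
    {a : (Module.End ℂ S)ˣ} (ha : a ∈ lpin ρ) :
    ∃ T : V →ₗ[ℝ] V, (∀ v, Q (T v) = Q v) ∧
      ∀ v, (a : Module.End ℂ S) * ρ (ι Q v) = ρ (ι Q (T v)) * a := by
  choose f hf using ((mem_lpin_iff ρ).1 ha).1
  -- Injectivity on V transfers linearity from conjugation by a to the chosen function; comparing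
  -- squares of vectors gives the isometry property.
  have hinj : ∀ v w, ρ (ι Q v) * (a : Module.End ℂ S) = ρ (ι Q w) * a → v = w := fun v w h =>
    map_ι_injective ρ hQ (a.mul_left_inj.1 h)
  refine ⟨{ toFun := f, map_add' := fun v w => hinj _ _ ?_, map_smul' := fun r v => hinj _ _ ?_ },
    fun v => ?_, hf⟩
  · rw [map_add, map_add, add_mul, ← hf, ← hf, ← hf, map_add, map_add, mul_add]
  · rw [map_smul, map_smul, smul_mul_assoc, RingHom.id_apply, ← hf, ← hf, map_smul, map_smul,
      mul_smul_comm]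
  · have hsq : ∀ w, ρ (ι Q w) * ρ (ι Q w) = algebraMap ℝ (Module.End ℂ S) (Q w) := fun w => by
      rw [← map_mul, ι_sq_scalar, AlgHom.commutes]
    refine (algebraMap ℝ (Module.End ℂ S)).injective (a.mul_left_inj.1 ?_)
    change _ * (a : Module.End ℂ S) = _
    rw [LinearMap.coe_mk, AddHom.coe_mk, ← hsq, mul_assoc, ← hf, ← mul_assoc, ← hf, mul_assoc,
      hsq, Algebra.commutes]

/-- The homomorphism `(c, b) ↦ c • b` from `ℂˣ × Pin(h)` to the Lipschitz group. -/
noncomputable def scalarMulHom : ℂˣ × pin Q →* lpin ρ :=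
  (MonoidHom.toHomUnits
    { toFun := fun x : ℂˣ × pin Q => (x.1 : ℂ) • ρ ((x.2 : (CliffordAlgebra Q)ˣ) :
        CliffordAlgebra Q)
      map_one' := by simp
      map_mul' := fun x y => by
        simp only [Prod.fst_mul, Prod.snd_mul, Units.val_mul, Subgroup.coe_mul, map_mul,
          smul_mul_smul_comm] }).codRestrict (lpin ρ) (by
    rintro ⟨c, b, hb⟩
    obtain ⟨h1, h2⟩ := conj_ι_of_mem_pin hb
    refine (mem_lpin_iff ρ).2 ⟨fun v => ?_, fun v => ?_⟩
    · obtain ⟨w, hw⟩ := h1 v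
      refine ⟨w, ?_⟩
      change ((c : ℂ) • ρ (b : CliffordAlgebra Q)) * _ = _ * ((c : ℂ) • ρ (b : CliffordAlgebra Q))
      rw [smul_mul_assoc, mul_smul_comm, ← map_mul, ← map_mul, hw]
    · obtain ⟨w, hw⟩ := h2 v
      refine ⟨w, ?_⟩
      change _ * ((c : ℂ) • ρ (b : CliffordAlgebra Q)) = ((c : ℂ) • ρ (b : CliffordAlgebra Q)) * _
      rw [smul_mul_assoc, mul_smul_comm, ← map_mul, ← map_mul, hw])

theorem scalarMulHom_apply (x : ℂˣ × pin Q) :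
    ((scalarMulHom ρ x : (Module.End ℂ S)ˣ) : Module.End ℂ S) =
      (x.1 : ℂ) • ρ ((x.2 : (CliffordAlgebra Q)ˣ) : CliffordAlgebra Q) := rfl

/-- The homomorphism `[(c, b)] ↦ c • b` from `ℂˣ · P` to the Lipschitz group. -/
noncomputable def scalarDotHom (P : Subgroup (CliffordAlgebra Q)ˣ) (hP : P ≤ pin Q) :
    ScalarDot Q P →* lpin ρ :=
  QuotientGroup.lift (signPairs Q P)
    ((scalarMulHom ρ).comp ((MonoidHom.id ℂˣ).prodMap (Subgroup.inclusion hP))) (by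
      rintro ⟨c, b⟩ (⟨h1, h2⟩ | ⟨h1, h2⟩) <;>
      · dsimp only at h1 h2
        apply Subtype.ext
        apply Units.ext
        simp [scalarMulHom_apply, h1, h2])

theorem scalarDotHom_mk (P : Subgroup (CliffordAlgebra Q)ˣ) (hP : P ≤ pin Q) (c : ℂˣ) (b : P) :
    ((scalarDotHom ρ P hP (QuotientGroup.mk (c, b)) : (Module.End ℂ S)ˣ) : Module.End ℂ S) =
      (c : ℂ) • ρ ((b : (CliffordAlgebra Q)ˣ) : CliffordAlgebra Q) := rfl

theorem scalarDotHom_injective (P : Subgroup (CliffordAlgebra Q)ˣ) (hP : P ≤ pin Q)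
    (h : ∀ (c : ℂ) (b : (CliffordAlgebra Q)ˣ), b ∈ pin Q → c • ρ (b : CliffordAlgebra Q) = 1 →
      (c = 1 ∧ b = 1) ∨ (c = -1 ∧ b = -1)) :
    Function.Injective (scalarDotHom ρ P hP) := by
  rw [injective_iff_map_eq_one]
  intro x hx
  induction x using QuotientGroup.induction_on with
  | H x =>
    obtain ⟨c, b⟩ := x
    have h1 := congrArg (fun y : lpin ρ => ((y : (Module.End ℂ S)ˣ) : Module.End ℂ S)) hx
    rw [QuotientGroup.eq_one_iff]
    rcases h c b (hP b.2) h1 with h | h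
    · exact Or.inl ⟨Units.ext h.1, h.2⟩
    · exact Or.inr ⟨Units.ext h.1, h.2⟩

theorem kappa_apply_eq {a : lpin ρ} {w w' : anti ρ}
    (h : ((a : (Module.End ℂ S)ˣ) : Module.End ℂ S) * w = w' * ((a : (Module.End ℂ S)ˣ) :
      Module.End ℂ S)) :
    (kappa ρ a : anti ρ ≃ₗ[ℂ] anti ρ) w = w' := by
  apply Subtype.ext
  change (kappaLin ρ a w : Module.End ℂ S) = w'
  rw [kappaLin_apply, h, mul_assoc, Units.mul_inv, mul_one]

/-- Moving w past b applies α to b, so κ(c b) is +1 or -1 according to the parity of b. -/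
theorem kappa_scalarMulHom_even (x : ℂˣ × pin Q)
    (hx : involute ((x.2 : (CliffordAlgebra Q)ˣ) : CliffordAlgebra Q) =
      ((x.2 : (CliffordAlgebra Q)ˣ) : CliffordAlgebra Q)) :
    kappa ρ (scalarMulHom ρ x) = 1 := by
  apply Subtype.ext
  ext w : 1
  refine kappa_apply_eq ρ ?_
  change _ = (w : Module.End ℂ S) * _
  rw [scalarMulHom_apply, mul_smul_comm, mul_map_of_mem_anti ρ w.2, hx, smul_mul_assoc]

theorem kappa_scalarMulHom_odd (x : ℂˣ × pin Q)
    (hx : involute ((x.2 : (CliffordAlgebra Q)ˣ) : CliffordAlgebra Q) =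
      -((x.2 : (CliffordAlgebra Q)ˣ) : CliffordAlgebra Q)) (w : anti ρ) :
    (kappa ρ (scalarMulHom ρ x) : anti ρ ≃ₗ[ℂ] anti ρ) w = -w := by
  refine kappa_apply_eq ρ ?_
  rw [scalarMulHom_apply, mul_smul_comm, Submodule.coe_neg, neg_mul,
    mul_map_of_mem_anti ρ w.2, hx, smul_mul_assoc, map_neg, neg_mul, neg_neg]

theorem antiForm_of_sq [FiniteDimensional ℂ S] [Nontrivial S] {w : anti ρ} {c : ℂ}
    (h : (w : Module.End ℂ S) * w = c • 1) : antiForm ρ w = c := by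
  have hd : (Module.finrank ℂ S : ℂ) ≠ 0 := Nat.cast_ne_zero.2 Module.finrank_pos.ne'
  rw [antiForm_apply, h, map_smul, LinearMap.trace_one, smul_eq_mul]
  field_simp

end Representation

/-! ### Orthogonal groups of a complex line and of a hyperbolic plane. -/

section OrthogonalGroups

variable {M : Type*} [AddCommGroup M] [Module ℂ M] {q : QuadraticForm ℂ M}

theorem orthogonalGroup_apply (T : orthogonalGroup q) (x : M) :
    q ((T : M ≃ₗ[ℂ] M) x) = q x := T.2 x

/-- The orthogonal group of a nonzero quadratic form on a line is `ℤ₂`. -/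
theorem exists_orthogonalGroup_equiv_units (L : ℂ ≃ₗ[ℂ] M) {k : ℂ} (hk : k ≠ 0)
    (hq : ∀ x, q (L x) = k * (x * x)) :
    ∃ e : orthogonalGroup q ≃* ℤˣ, ∀ T : orthogonalGroup q,
      (∀ x, (T : M ≃ₗ[ℂ] M) x = -x) → e T = -1 := by
  have hcases : ∀ T : orthogonalGroup q, T = 1 ∨ ∀ x, (T : M ≃ₗ[ℂ] M) x = -x := by
    intro T
    obtain ⟨t, ht⟩ := L.surjective ((T : M ≃ₗ[ℂ] M) (L 1))
    have h1 : q ((T : M ≃ₗ[ℂ] M) (L 1)) = q (L 1) := T.2 _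
    have h2 : ∀ x, (T : M ≃ₗ[ℂ] M) (L x) = L (t * x) := fun x => by
      have hx : x = x • (1 : ℂ) := by simp
      rw [hx, map_smul, map_smul, ← ht, ← map_smul]
      simp [mul_comm]
    rw [← ht, hq, hq] at h1
    have h3 : t * t = 1 := by simpa using mul_left_cancel₀ hk h1
    rcases mul_self_eq_one_iff.1 h3 with h | h
    · left
      apply Subtype.ext
      ext x
      obtain ⟨x, rfl⟩ := L.surjective x
      simp [h2, h]
    · right
      intro x
      obtain ⟨x, rfl⟩ := L.surjective x
      simp [h2, h]
  have hneg : ∀ x, (LinearEquiv.neg ℂ : M ≃ₗ[ℂ] M) x = -x := fun x => rfl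
  have hmem : (LinearEquiv.neg ℂ : M ≃ₗ[ℂ] M) ∈ orthogonalGroup q := fun x => by
    rw [hneg, QuadraticMap.map_neg]
  have hLne : -L 1 ≠ L 1 := fun h => by
    have h' : L (-1) = L 1 := by rw [map_neg, h]
    have := L.injective h'
    norm_num at this
  have hne : ∀ T : orthogonalGroup q, (∀ x, (T : M ≃ₗ[ℂ] M) x = -x) → T ≠ 1 := by
    rintro T hT rfl
    exact hLne (hT (L 1)).symm
  have hsq : (⟨_, hmem⟩ * ⟨_, hmem⟩ : orthogonalGroup q) = 1 := by
    apply Subtype.ext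
    ext x
    change - -x = x
    simp
  let f : ℤˣ →* orthogonalGroup q := signHom _ hsq
  have hf : Function.Bijective f := by
    constructor
    · rw [injective_iff_map_eq_one]
      intro ε hε
      rcases Int.units_eq_one_or ε with rfl | rfl
      · rfl
      · exact absurd hε (hne _ fun x => rfl)
    · intro T
      rcases hcases T with rfl | h
      · exact ⟨1, map_one f⟩
      · refine ⟨-1, Subtype.ext ?_⟩
        ext x
        exact (h x).symm
  refine ⟨(MulEquiv.ofBijective f hf).symm, fun T hT => ?_⟩
  rw [MulEquiv.symm_apply_eq]
  apply Subtype.ext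
  ext x
  exact hT x

/-- The action of `ℂˣ` on a hyperbolic plane with coordinates `L`. -/
def hyperbolicScale (L : (ℂ × ℂ) ≃ₗ[ℂ] M) (z : ℂˣ) : M ≃ₗ[ℂ] M :=
  L.symm.trans (((LinearEquiv.smulOfUnit z).prodCongr
    (LinearEquiv.smulOfUnit z⁻¹)).trans L)

theorem hyperbolicScale_apply (L : (ℂ × ℂ) ≃ₗ[ℂ] M) (z : ℂˣ) (x y : ℂ) :
    hyperbolicScale L z (L (x, y)) = L (z * x, (z⁻¹ : ℂˣ) * y) := by
  simp only [hyperbolicScale, LinearEquiv.trans_apply, LinearEquiv.symm_apply_apply]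
  rfl

/-- The exchange of the two isotropic lines of a hyperbolic plane with coordinates `L`. -/
def hyperbolicSwap (L : (ℂ × ℂ) ≃ₗ[ℂ] M) : M ≃ₗ[ℂ] M :=
  L.symm.trans ((LinearEquiv.prodComm ℂ ℂ ℂ).trans L)

theorem hyperbolicSwap_apply (L : (ℂ × ℂ) ≃ₗ[ℂ] M) (x y : ℂ) :
    hyperbolicSwap L (L (x, y)) = L (y, x) := by
  simp [hyperbolicSwap]

theorem orthogonalGroup_ext (L : (ℂ × ℂ) ≃ₗ[ℂ] M) {T T' : orthogonalGroup q}
    (h : ∀ x y, (T : M ≃ₗ[ℂ] M) (L (x, y)) = (T' : M ≃ₗ[ℂ] M) (L (x, y))) : T = T' := by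
  apply Subtype.ext
  ext m
  obtain ⟨⟨x, y⟩, rfl⟩ := L.surjective m
  exact h x y

/-- The orthogonal group of a complex hyperbolic plane is `ℤ₂ ⋉ ℂˣ`. -/
theorem exists_orthogonalGroup_equiv_semidirect (L : (ℂ × ℂ) ≃ₗ[ℂ] M)
    (hq : ∀ x y, q (L (x, y)) = x * y) :
    ∃ e : orthogonalGroup q ≃* ℂˣ ⋊[phi] ℤˣ, ∀ (T : orthogonalGroup q) (z : ℂˣ),
      ((∀ x y, (T : M ≃ₗ[ℂ] M) (L (x, y)) = L (z * x, (z⁻¹ : ℂˣ) * y)) → e T = ⟨z, 1⟩) ∧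
      ((∀ x y, (T : M ≃ₗ[ℂ] M) (L (x, y)) = L (z * y, (z⁻¹ : ℂˣ) * x)) → e T = ⟨z, -1⟩) := by
  have hsc : ∀ z, hyperbolicScale L z ∈ orthogonalGroup q := fun z m => by
    obtain ⟨⟨x, y⟩, rfl⟩ := L.surjective m
    rw [hyperbolicScale_apply, hq, hq, mul_mul_mul_comm, Units.mul_inv, one_mul]
  have hsw : hyperbolicSwap L ∈ orthogonalGroup q := fun m => by
    obtain ⟨⟨x, y⟩, rfl⟩ := L.surjective m
    rw [hyperbolicSwap_apply, hq, hq, mul_comm]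
  have hss : (⟨_, hsw⟩ * ⟨_, hsw⟩ : orthogonalGroup q) = 1 :=
    orthogonalGroup_ext L fun x y => by
      change hyperbolicSwap L (hyperbolicSwap L (L (x, y))) = L (x, y)
      rw [hyperbolicSwap_apply, hyperbolicSwap_apply]
  let f₁ : ℂˣ →* orthogonalGroup q := MonoidHom.mk' (fun z => ⟨_, hsc z⟩) fun z w =>
    orthogonalGroup_ext L fun x y => by
      change hyperbolicScale L (z * w) (L (x, y)) =
        hyperbolicScale L z (hyperbolicScale L w (L (x, y)))
      simp only [hyperbolicScale_apply, Units.val_mul, mul_inv, mul_assoc]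
  -- Conjugation by the swap inverts the scaling, which is exactly the action φ.
  have hcompat : ∀ ε : ℤˣ, f₁.comp (phi ε).toMonoidHom =
      (MulAut.conj (signHom (⟨_, hsw⟩ : orthogonalGroup q) hss ε)).toMonoidHom.comp f₁ := by
    intro ε
    ext1 z
    simp only [MonoidHom.comp_apply, MulEquiv.toMonoidHom_eq_coe, MonoidHom.coe_coe,
      MulAut.conj_apply]
    rw [eq_mul_inv_iff_mul_eq]
    rcases Int.units_eq_one_or ε with rfl | rfl
    · simp
    · rw [signHom_neg_one]
      refine orthogonalGroup_ext L fun x y => ?_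
      have hz : phi (-1) z = z⁻¹ := by simp [phi]
      rw [hz]
      change hyperbolicScale L z⁻¹ (hyperbolicSwap L (L (x, y))) =
        hyperbolicSwap L (hyperbolicScale L z (L (x, y)))
      simp only [hyperbolicScale_apply, hyperbolicSwap_apply, inv_inv]
  let f : ℂˣ ⋊[phi] ℤˣ →* orthogonalGroup q := SemidirectProduct.lift f₁ _ hcompat
  have hf_one : ∀ z x y, (f ⟨z, 1⟩ : M ≃ₗ[ℂ] M) (L (x, y)) = L (z * x, (z⁻¹ : ℂˣ) * y) := by
    intro z x y
    change hyperbolicScale L z (L (x, y)) = _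
    rw [hyperbolicScale_apply]
  have hf_neg : ∀ z x y, (f ⟨z, -1⟩ : M ≃ₗ[ℂ] M) (L (x, y)) = L (z * y, (z⁻¹ : ℂˣ) * x) := by
    intro z x y
    change hyperbolicScale L z (hyperbolicSwap L (L (x, y))) = _
    rw [hyperbolicSwap_apply, hyperbolicScale_apply]
  have hbij : Function.Bijective f := by
    constructor
    · rw [injective_iff_map_eq_one]
      rintro ⟨z, ε⟩ h
      have h10 : (f ⟨z, ε⟩ : M ≃ₗ[ℂ] M) (L (1, 0)) = L (1, 0) := by rw [h]; rfl
      rcases Int.units_eq_one_or ε with rfl | rfl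
      · rw [hf_one, L.injective.eq_iff] at h10
        have hz : z = 1 := by simpa using h10
        rw [hz]
        rfl
      · rw [hf_neg, L.injective.eq_iff] at h10
        simp at h10
    · intro T
      obtain ⟨⟨a, b⟩, hab⟩ := L.surjective ((T : M ≃ₗ[ℂ] M) (L (1, 0)))
      obtain ⟨⟨c, d⟩, hcd⟩ := L.surjective ((T : M ≃ₗ[ℂ] M) (L (0, 1)))
      have hT : ∀ x y, (T : M ≃ₗ[ℂ] M) (L (x, y)) = L (x * a + y * c, x * b + y * d) := by
        intro x y
        have hxy : (x, y) = x • ((1, 0) : ℂ × ℂ) + y • ((0, 1) : ℂ × ℂ) := by simp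
        rw [hxy, map_add, map_smul, map_smul, map_add, map_smul, map_smul, ← hab, ← hcd,
          ← map_smul, ← map_smul, ← map_add]
        simp
      have hqT : ∀ x y, (x * a + y * c) * (x * b + y * d) = x * y := fun x y => by
        rw [← hq, ← hT, orthogonalGroup_apply, hq]
      -- T sends the two isotropic basis vectors to isotropic ones and keeps their pairing, so its
      -- matrix is diagonal or antidiagonal with product of entries 1.
      have h1 : a * b = 0 := by simpa using hqT 1 0
      have h2 : c * d = 0 := by simpa using hqT 0 1
      have h3 : a * d + c * b = 1 := by
        have := hqT 1 1
        linear_combination this - h1 - h2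
      rcases mul_eq_zero.1 h1 with ha | hb
      · rw [ha, zero_mul, zero_add] at h3
        have hd : d = 0 := by
          rcases mul_eq_zero.1 h2 with h | h
          · simp [h] at h3
          · exact h
        refine ⟨⟨⟨c, b, h3, by rw [mul_comm, h3]⟩, -1⟩, orthogonalGroup_ext L fun x y => ?_⟩
        rw [hf_neg, hT, ha, hd]
        simp [mul_comm]
      · rw [hb, mul_zero, add_zero] at h3
        have hc : c = 0 := by
          rcases mul_eq_zero.1 h2 with h | h
          · exact h
          · simp [h] at h3
        refine ⟨⟨⟨a, d, h3, by rw [mul_comm, h3]⟩, 1⟩, orthogonalGroup_ext L fun x y => ?_⟩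
        rw [hf_one, hT, hb, hc]
        simp [mul_comm]
  refine ⟨(MulEquiv.ofBijective f hbij).symm, fun T z => ⟨fun h => ?_, fun h => ?_⟩⟩
  · rw [MulEquiv.symm_apply_eq]
    exact orthogonalGroup_ext L fun x y => (h x y).trans (hf_one z x y).symm
  · rw [MulEquiv.symm_apply_eq]
    exact orthogonalGroup_ext L fun x y => (h x y).trans (hf_neg z x y).symm

end OrthogonalGroups

/-! ### Odd elements of Pin and comparison of two lifts of one isometry. -/

section Common

variable {V : Type*} [AddCommGroup V] [Module ℝ V] {Q : QuadraticForm ℝ V}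

theorem spin_le_pin : spin Q ≤ pin Q := fun _ h => h.1

/-- A basis vector serves; this is where m ≥ 1 enters. -/
theorem exists_odd_mem_pin [FiniteDimensional ℝ V] (hQ : Q.Nondegenerate)
    (hpos : 0 < Module.finrank ℝ V) :
    ∃ u ∈ pin Q, involute (u : CliffordAlgebra Q) = -(u : CliffordAlgebra Q) ∧
      (u * u = 1 ∨ u * u = -1) := by
  obtain ⟨e, he⟩ := exists_isOrthonormalBasis hQ
  obtain ⟨u, hu, h⟩ := exists_mem_pin_eq_ι (he.unit ⟨0, hpos⟩)
  refine ⟨u, hu, by rw [h, involute_ι], ?_⟩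
  rcases ι_mul_ι_of_unit (he.unit ⟨0, hpos⟩) with h1 | h1
  · left; ext; rw [Units.val_mul, h, h1]; rfl
  · right; ext; rw [Units.val_mul, h, h1]; rfl

variable {S : Type*} [AddCommGroup S] [Module ℂ S] (ρ : CliffordAlgebra Q →ₐ[ℝ] Module.End ℂ S)

theorem map_mul_map_inv (b : (CliffordAlgebra Q)ˣ) :
    ρ (b : CliffordAlgebra Q) * ρ ((b⁻¹ : (CliffordAlgebra Q)ˣ) : CliffordAlgebra Q) = 1 := by
  rw [← map_mul, Units.mul_inv, map_one]

/-- If `a` and `t` act on vectors in the same way, then `t⁻¹ a` commutes with all vectors. -/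
theorem inv_mul_commute {a t : (Module.End ℂ S)ˣ} {T : V → V}
    (ha : ∀ v, (a : Module.End ℂ S) * ρ (ι Q v) = ρ (ι Q (T v)) * a)
    (ht : ∀ v, (t : Module.End ℂ S) * ρ (ι Q v) = ρ (ι Q (T v)) * t) (v : V) :
    ((t⁻¹ * a : (Module.End ℂ S)ˣ) : Module.End ℂ S) * ρ (ι Q v) =
      ρ (ι Q v) * (t⁻¹ * a : (Module.End ℂ S)ˣ) := by
  have h : ρ (ι Q v) * ((t⁻¹ : (Module.End ℂ S)ˣ) : Module.End ℂ S) =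
      ((t⁻¹ : (Module.End ℂ S)ˣ) : Module.End ℂ S) * ρ (ι Q (T v)) := by
    rw [Units.mul_inv_eq_iff_eq_mul, mul_assoc, ← ht, Units.inv_mul_cancel_left]
  rw [Units.val_mul, mul_assoc, ha, ← mul_assoc, ← h, mul_assoc]

end Common

/-! ### Even dimension: Dirac representations. -/

section Even

variable {V : Type*} [AddCommGroup V] [Module ℝ V] {Q : QuadraticForm ℝ V} {S : Type*} [AddCommGroup S] [Module ℂ S]
  {ρ : CliffordAlgebra Q →ₐ[ℝ] Module.End ℂ S}

theorem IsDirac.finiteDimensional (hρ : IsDirac ρ) : FiniteDimensional ℂ S :=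
  Module.finite_of_finrank_pos (by rw [hρ.finrank_eq]; positivity)

theorem IsDirac.nontrivial (hρ : IsDirac ρ) : Nontrivial S :=
  Module.nontrivial_of_finrank_pos (R := ℂ) (by rw [hρ.finrank_eq]; positivity)

theorem IsDirac.exists_eq_smul_one (hρ : IsDirac ρ) {w : Module.End ℂ S}
    (hw : ∀ v, w * ρ (ι Q v) = ρ (ι Q v) * w) : ∃ c : ℂ, w = c • 1 := by
  have := hρ.finiteDimensional
  have := hρ.nontrivial
  refine exists_eq_smul_one_of_commute (Set.range ρ) (fun W hW => hρ.irreducible W ?_) w ?_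
  · exact fun a => hW _ ⟨a, rfl⟩
  · rintro _ ⟨a, rfl⟩
    exact mul_map_of_commute ρ hw a

variable [FiniteDimensional ℝ V]

theorem exists_volume_of_even (hQ : Q.Nondegenerate) (hm : Even (Module.finrank ℝ V)) :
    ∃ η ∈ pin Q, involute (η : CliffordAlgebra Q) = η ∧
      ∀ v, (η : CliffordAlgebra Q) * ι Q v = -(ι Q v * η) := by
  obtain ⟨η, hη, h1, h2⟩ := exists_volume hQ
  rw [hm.neg_one_pow, one_mul] at h1
  exact ⟨η, hη, h1, fun v => by rw [← h2, h1]⟩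

/-- In even dimension, isometries are untwisted conjugations by elements of the Pin group. -/
theorem exists_conj_of_isometry_of_even (hQ : Q.Nondegenerate) (hm : Even (Module.finrank ℝ V))
    (T : V →ₗ[ℝ] V) (hT : ∀ v, Q (T v) = Q v) :
    ∃ b ∈ pin Q, ∀ v, (b : CliffordAlgebra Q) * ι Q v = ι Q (T v) * b := by
  obtain ⟨b, hb, h⟩ := isTwistedConj_of_isometry hQ T hT
  rcases involute_of_mem_pin Q hb with h' | h'
  · exact ⟨b, hb, fun v => by rw [← h, h']⟩
  -- For odd b, twisted and plain conjugation differ by a sign, which the anticommuting volume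
  -- element supplies.
  · obtain ⟨η, hη, -, hv⟩ := exists_volume_of_even hQ hm
    refine ⟨b * η, mul_mem hb hη, fun v => ?_⟩
    rw [Units.val_mul, mul_assoc, hv, mul_neg, ← mul_assoc, ← neg_mul, ← neg_mul, ← h', h,
      mul_assoc]

/-- By faithfulness b is central. An odd b would also anticommute with the volume element, so b is
even, hence a real scalar in Pin. -/
theorem IsDirac.eq_one_or_neg_one (hρ : IsDirac ρ) (hQ : Q.Nondegenerate)
    (hm : Even (Module.finrank ℝ V)) (c : ℂ) (b : (CliffordAlgebra Q)ˣ) (hb : b ∈ pin Q)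
    (h : c • ρ (b : CliffordAlgebra Q) = 1) : (c = 1 ∧ b = 1) ∨ (c = -1 ∧ b = -1) := by
  have := hρ.nontrivial
  have hone : ∀ d : ℂ, d • (1 : Module.End ℂ S) = 1 → d = 1 := fun d hd =>
    smul_left_injective ℂ (one_ne_zero (α := Module.End ℂ S)) (by simpa using hd)
  have hc : c ≠ 0 := by
    rintro rfl
    rw [zero_smul] at h
    exact zero_ne_one h
  have hρb : ρ (b : CliffordAlgebra Q) = c⁻¹ • 1 := by
    rw [← h, smul_smul, inv_mul_cancel₀ hc, one_smul]
  have hcomm : ∀ x : CliffordAlgebra Q, x * b = b * x := fun x => hρ.faithful (by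
    rw [map_mul, map_mul, hρb, mul_smul_comm, smul_mul_assoc, mul_one, one_mul])
  have heven : involute (b : CliffordAlgebra Q) = b := by
    refine (involute_of_mem_pin Q hb).resolve_right fun hodd => ?_
    obtain ⟨η, -, -, hη⟩ := exists_volume_of_even hQ hm
    have hanti : ρ (η : CliffordAlgebra Q) ∈ anti ρ := fun v => by
      rw [← map_mul, ← map_mul, hη, map_neg, neg_add_cancel]
    have h1 := mul_map_of_mem_anti ρ hanti b
    rw [hodd, ← map_mul, ← map_mul] at h1
    have h2 := hρ.faithful h1
    rw [hcomm, neg_mul, ← Units.val_mul] at h2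
    exact neg_ne Q _ h2.symm
  rcases eq_one_or_neg_one_of_mem_pin hb
    (mem_span_one_of_central_even hQ heven fun v => hcomm _) with rfl | rfl
  · refine Or.inl ⟨hone c ?_, rfl⟩
    simpa using h
  · refine Or.inr ⟨?_, rfl⟩
    rw [eq_neg_iff_add_eq_zero, ← neg_eq_zero, neg_add, ← sub_eq_add_neg, sub_eq_zero]
    exact hone _ (by simpa using h)

/-- The isometry induced by a is also induced by some b in Pin, so ρ(b)⁻¹ a commutes with V and is a
scalar by Schur's lemma. -/
theorem IsDirac.scalarMulHom_surjective (hρ : IsDirac ρ) (hQ : Q.Nondegenerate)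
    (hm : Even (Module.finrank ℝ V)) : Function.Surjective (scalarMulHom ρ) := by
  have := hρ.nontrivial
  rintro ⟨a, ha⟩
  obtain ⟨T, hT, haT⟩ := exists_isometry_of_mem_lpin ρ hQ ha
  obtain ⟨b, hb, hbT⟩ := exists_conj_of_isometry_of_even hQ hm T hT
  set t : (Module.End ℂ S)ˣ := Units.map (ρ : CliffordAlgebra Q →* Module.End ℂ S) b with ht
  have htb : (t : Module.End ℂ S) = ρ (b : CliffordAlgebra Q) := rfl
  obtain ⟨c, hc⟩ := hρ.exists_eq_smul_one (inv_mul_commute ρ haT (t := t) fun v => by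
    rw [htb, ← map_mul, ← map_mul, hbT])
  have hab : (a : Module.End ℂ S) = c • ρ (b : CliffordAlgebra Q) := by
    rw [← mul_inv_cancel_left t a, Units.val_mul, hc, mul_smul_comm, mul_one, htb]
  have hc0 : c ≠ 0 := by
    rintro rfl
    rw [zero_smul] at hab
    exact a.ne_zero hab
  refine ⟨(Units.mk0 c hc0, ⟨b, hb⟩), ?_⟩
  apply Subtype.ext
  apply Units.ext
  exact hab.symm

/-- In even dimension, the space `A(h)` is a line with a non-zero quadratic form. -/
theorem IsDirac.exists_anti_equiv (hρ : IsDirac ρ) (hQ : Q.Nondegenerate)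
    (hm : Even (Module.finrank ℝ V)) :
    ∃ (L : ℂ ≃ₗ[ℂ] anti ρ) (k : ℂ), k ≠ 0 ∧
      ∀ x, ((L x : Module.End ℂ S) * L x) = (k * (x * x)) • 1 := by
  have := hρ.nontrivial
  obtain ⟨η, -, -, hη⟩ := exists_volume_of_even hQ hm
  have hanti : ρ (η : CliffordAlgebra Q) ∈ anti ρ := fun v => by
    rw [← map_mul, ← map_mul, hη, map_neg, neg_add_cancel]
  -- A product of two elements anticommuting with V commutes with V, so w η is a scalar; as η² = k ≠
  -- 0, w is a multiple of η.
  have hcomm : ∀ w ∈ anti ρ, ∀ v, (w * ρ (η : CliffordAlgebra Q)) * ρ (ι Q v) =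
      ρ (ι Q v) * (w * ρ (η : CliffordAlgebra Q)) := by
    intro w hw v
    rw [mul_assoc, mul_map_of_mem_anti ρ hanti, ← mul_assoc, mul_map_of_mem_anti ρ hw,
      involute_involute, mul_assoc]
  obtain ⟨k, hk⟩ := hρ.exists_eq_smul_one (hcomm _ hanti)
  have hη0 : ρ (η : CliffordAlgebra Q) ≠ 0 := fun h => by
    have h1 := map_mul_map_inv ρ η
    rw [h, zero_mul] at h1
    exact zero_ne_one h1
  have hk0 : k ≠ 0 := by
    rintro rfl
    apply hη0
    rw [zero_smul, ← map_mul] at hk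
    have h1 : ρ ((η * η : (CliffordAlgebra Q)ˣ) : CliffordAlgebra Q) = 0 := hk
    have h2 := map_mul_map_inv ρ (η * η)
    rw [h1, zero_mul] at h2
    exact absurd h2 zero_ne_one
  let Γ : anti ρ := ⟨_, hanti⟩
  have hbij : Function.Bijective (LinearMap.toSpanSingleton ℂ (anti ρ) Γ) := by
    constructor
    · intro x y hxy
      exact smul_left_injective ℂ hη0 (congrArg Subtype.val hxy)
    · intro w
      obtain ⟨c, hc⟩ := hρ.exists_eq_smul_one (hcomm w w.2)
      refine ⟨k⁻¹ * c, Subtype.ext ?_⟩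
      have h1 : (w : Module.End ℂ S) * ρ (η : CliffordAlgebra Q) * ρ (η : CliffordAlgebra Q) =
          k • (w : Module.End ℂ S) := by
        rw [mul_assoc, hk, mul_smul_comm, mul_one]
      rw [hc, smul_mul_assoc, one_mul] at h1
      change (k⁻¹ * c) • ρ (η : CliffordAlgebra Q) = w
      rw [mul_smul, h1, smul_smul, inv_mul_cancel₀ hk0, one_smul]
  refine ⟨LinearEquiv.ofBijective _ hbij, k, hk0, fun x => ?_⟩
  change (x • ρ (η : CliffordAlgebra Q)) * (x • ρ (η : CliffordAlgebra Q)) = _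
  rw [smul_mul_smul_comm, hk, smul_smul, mul_comm]

theorem IsDirac.exists_split_extension (hρ : IsDirac ρ) (hQ : Q.Nondegenerate)
    (hpos : 0 < Module.finrank ℝ V) (hm : Even (Module.finrank ℝ V)) :
    ∃ e : orthogonalGroup (antiForm ρ) ≃* ℤˣ,
      ∃ E : GroupExtension (ScalarDot Q (spin Q)) (lpin ρ) ℤˣ,
        (∀ (c : ℂˣ) (a : spin Q),
          ((E.inl (QuotientGroup.mk (c, a)) : (Module.End ℂ S)ˣ) : Module.End ℂ S) =
            (c : ℂ) • ρ ((a : (CliffordAlgebra Q)ˣ) : CliffordAlgebra Q)) ∧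
        E.rightHom = e.toMonoidHom.comp (kappa ρ) ∧ Nonempty E.Splitting := by
  have := hρ.nontrivial
  have := hρ.finiteDimensional
  obtain ⟨L, k, hk, hL⟩ := hρ.exists_anti_equiv hQ hm
  obtain ⟨e, he⟩ := exists_orthogonalGroup_equiv_units L hk fun x => antiForm_of_sq ρ (hL x)
  have hodd : ∀ x : ℂˣ × pin Q, involute ((x.2 : (CliffordAlgebra Q)ˣ) : CliffordAlgebra Q) =
      -((x.2 : (CliffordAlgebra Q)ˣ) : CliffordAlgebra Q) →
      e (kappa ρ (scalarMulHom ρ x)) = -1 :=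
    fun x hx => he _ (kappa_scalarMulHom_odd ρ x hx)
  obtain ⟨u, hu, hu1, hu2⟩ := exists_odd_mem_pin hQ hpos
  -- The splitting needs an involution over -1: the odd unit vector u when u² = 1, and i u when u² =
  -- -1.
  obtain ⟨c, hc⟩ : ∃ c : ℂˣ, scalarMulHom ρ (c, ⟨u, hu⟩) * scalarMulHom ρ (c, ⟨u, hu⟩) = 1 := by
    have key : ∀ c : ℂˣ, (((scalarMulHom ρ (c, ⟨u, hu⟩) * scalarMulHom ρ (c, ⟨u, hu⟩) : lpin ρ) :
        (Module.End ℂ S)ˣ) : Module.End ℂ S) =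
        ((c : ℂ) * c) • ρ ((u * u : (CliffordAlgebra Q)ˣ) : CliffordAlgebra Q) := fun c => by
      rw [← map_mul, scalarMulHom_apply]
      simp
    rcases hu2 with h | h
    · refine ⟨1, Subtype.ext (Units.ext ?_)⟩
      rw [key, h]
      simp
    · refine ⟨Units.mk0 Complex.I Complex.I_ne_zero, Subtype.ext (Units.ext ?_)⟩
      rw [key, h]
      simp
  have hs := hodd (c, ⟨u, hu⟩) hu1
  have hright : ∀ ε, e (kappa ρ (signHom _ hc ε)) = ε := fun ε => by
    rcases Int.units_eq_one_or ε with rfl | rfl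
    · simp
    · exact hs
  refine ⟨e, ⟨scalarDotHom ρ (spin Q) spin_le_pin, e.toMonoidHom.comp (kappa ρ),
    scalarDotHom_injective ρ _ _ (hρ.eq_one_or_neg_one hQ hm), ?_, fun ε => ⟨_, hright ε⟩⟩,
    scalarDotHom_mk ρ _ _, rfl, ⟨⟨signHom _ hc, hright⟩⟩⟩
  ext a
  rw [MonoidHom.mem_range, MonoidHom.mem_ker]
  constructor
  · rintro ⟨x, rfl⟩
    induction x using QuotientGroup.induction_on with
    | H x =>
      have := kappa_scalarMulHom_even ρ (x.1, ⟨x.2, spin_le_pin x.2.2⟩)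
        ((mem_even_iff Q _).1 x.2.2.2)
      exact (congrArg e this).trans (map_one e)
  · intro ha
    obtain ⟨⟨c, b, hb⟩, rfl⟩ := hρ.scalarMulHom_surjective hQ hm a
    rcases involute_of_mem_pin Q hb with h | h
    · exact ⟨QuotientGroup.mk (c, ⟨b, hb, (mem_even_iff Q _).2 h⟩), rfl⟩
    · have h1 := (hodd (c, ⟨b, hb⟩) h).symm.trans ha
      exact absurd h1 (by decide)

theorem IsDirac.exists_scalarDot_equiv (hρ : IsDirac ρ) (hQ : Q.Nondegenerate)
    (hm : Even (Module.finrank ℝ V)) :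
    ∃ f : ScalarDot Q (pin Q) ≃* lpin ρ,
      ∀ (c : ℂˣ) (a : pin Q),
        ((f (QuotientGroup.mk (c, a)) : (Module.End ℂ S)ˣ) : Module.End ℂ S) =
          (c : ℂ) • ρ ((a : (CliffordAlgebra Q)ˣ) : CliffordAlgebra Q) := by
  refine ⟨MulEquiv.ofBijective (scalarDotHom ρ (pin Q) le_rfl)
    ⟨scalarDotHom_injective ρ _ _ (hρ.eq_one_or_neg_one hQ hm), fun a => ?_⟩,
    scalarDotHom_mk ρ _ _⟩
  obtain ⟨x, rfl⟩ := hρ.scalarMulHom_surjective hQ hm a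
  exact ⟨QuotientGroup.mk x, rfl⟩

theorem IsDirac.mul_self_eq (hρ : IsDirac ρ) (hQ : Q.Nondegenerate)
    (hm : Even (Module.finrank ℝ V)) (w : anti ρ) :
    (w : Module.End ℂ S) * w = antiForm ρ w • (1 : Module.End ℂ S) := by
  have := hρ.nontrivial
  have := hρ.finiteDimensional
  obtain ⟨L, k, -, hL⟩ := hρ.exists_anti_equiv hQ hm
  obtain ⟨x, rfl⟩ := L.surjective w
  rw [antiForm_of_sq ρ (hL x), hL]

end Even

/-! ### Scalar 2 × 2 block matrices on F × F. -/

section Block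

variable {S F : Type*} [AddCommGroup S] [Module ℂ S] [AddCommGroup F] [Module ℂ F]
  (e : S ≃ₗ[ℂ] F × F)

/-- The endomorphism of `S ≃ F × F` with the scalar block matrix `!![α, β; γ, δ]`. -/
def blockEnd (α β γ δ : ℂ) : Module.End ℂ S :=
  e.symm.toLinearMap ∘ₗ
    ((α • LinearMap.fst ℂ F F + β • LinearMap.snd ℂ F F).prod
      (γ • LinearMap.fst ℂ F F + δ • LinearMap.snd ℂ F F)) ∘ₗ e.toLinearMap

theorem blockEnd_apply (α β γ δ : ℂ) (s : S) :
    e (blockEnd e α β γ δ s) =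
      (α • (e s).1 + β • (e s).2, γ • (e s).1 + δ • (e s).2) := by
  simp [blockEnd]

theorem blockEnd_mul (α β γ δ α' β' γ' δ' : ℂ) :
    blockEnd e α β γ δ * blockEnd e α' β' γ' δ' =
      blockEnd e (α * α' + β * γ') (α * β' + β * δ') (γ * α' + δ * γ') (γ * β' + δ * δ') := by
  ext s
  apply e.injective
  rw [Module.End.mul_apply, blockEnd_apply, blockEnd_apply, blockEnd_apply]
  ext
  · simp only; module
  · simp only; module

theorem blockEnd_smul (c : ℂ) (α β γ δ : ℂ) :
    c • blockEnd e α β γ δ = blockEnd e (c * α) (c * β) (c * γ) (c * δ) := by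
  ext s
  apply e.injective
  simp [blockEnd_apply, mul_smul]

theorem blockEnd_neg (α β γ δ : ℂ) :
    -blockEnd e α β γ δ = blockEnd e (-α) (-β) (-γ) (-δ) := by
  rw [← neg_one_smul ℂ, blockEnd_smul]
  simp only [neg_one_mul]

theorem blockEnd_one : blockEnd e 1 0 0 1 = 1 := by
  ext s
  apply e.injective
  simp [blockEnd_apply]

theorem blockEnd_injective [Nontrivial F] {α β γ δ α' β' γ' δ' : ℂ}
    (h : blockEnd e α β γ δ = blockEnd e α' β' γ' δ') :
    α = α' ∧ β = β' ∧ γ = γ' ∧ δ = δ' := by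
  obtain ⟨x, hx⟩ := exists_ne (0 : F)
  have hs : ∀ c d : ℂ, c • x = d • x → c = d := fun c d h => smul_left_injective ℂ hx h
  have h1 := congrArg (fun f => e (f (e.symm (x, 0)))) h
  have h2 := congrArg (fun f => e (f (e.symm (0, x)))) h
  simp only [blockEnd_apply, LinearEquiv.apply_symm_apply, smul_zero, add_zero, zero_add,
    Prod.mk.injEq] at h1 h2
  exact ⟨hs _ _ h1.1, hs _ _ h2.1, hs _ _ h1.2, hs _ _ h2.2⟩

end Block

/-! ### Odd dimension: commutant and anticommutant of a Cartan representation. -/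

section Odd

variable {V : Type*} [AddCommGroup V] [Module ℝ V] {Q : QuadraticForm ℝ V}
  {S F : Type*} [AddCommGroup S] [Module ℂ S] [AddCommGroup F] [Module ℂ F]
  {ρ : CliffordAlgebra Q →ₐ[ℝ] Module.End ℂ S} {σ : CliffordAlgebra Q →ₐ[ℝ] Module.End ℂ F}
  {e : S ≃ₗ[ℂ] F × F}

/-- The equivalence `e` identifies `ρ` with `σ ⊕ (σ ∘ α)`, where `σ` is an extended Pauli
representation. -/
structure IsCartanVia (ρ : CliffordAlgebra Q →ₐ[ℝ] Module.End ℂ S)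
    (σ : CliffordAlgebra Q →ₐ[ℝ] Module.End ℂ F) (e : S ≃ₗ[ℂ] F × F) : Prop where
  isPauli : IsPauli σ
  apply_eq : ∀ a s, e (ρ a s) = (σ a (e s).1, σ (involute a) (e s).2)

theorem IsPauli.finiteDimensional (hσ : IsPauli σ) : FiniteDimensional ℂ F :=
  Module.finite_of_finrank_pos (by rw [hσ.finrank_eq]; positivity)

theorem IsPauli.nontrivial (hσ : IsPauli σ) : Nontrivial F :=
  Module.nontrivial_of_finrank_pos (R := ℂ) (by rw [hσ.finrank_eq]; positivity)

theorem IsPauli.exists_eq_smul_one (hσ : IsPauli σ) {f : Module.End ℂ F}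
    (hf : ∀ a, involute a = a → f * σ a = σ a * f) : ∃ c : ℂ, f = c • 1 := by
  have := hσ.finiteDimensional
  have := hσ.nontrivial
  refine exists_eq_smul_one_of_commute (σ '' {a | a ∈ evenOdd Q 0})
    (fun W hW => hσ.irreducible W ?_) f ?_
  · exact fun a ha => hW _ ⟨a, ha, rfl⟩
  · rintro _ ⟨a, ha, rfl⟩
    exact hf a ((mem_even_iff Q a).1 ha)

namespace IsCartanVia

theorem nontrivial (h : IsCartanVia ρ σ e) : Nontrivial S :=
  have := h.isPauli.nontrivial
  e.toEquiv.nontrivial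

theorem finiteDimensional (h : IsCartanVia ρ σ e) : FiniteDimensional ℂ S :=
  have := h.isPauli.finiteDimensional
  e.symm.finiteDimensional

/-- On even elements ρ is σ ⊕ σ, so each of the four blocks of w commutes with σ(Cl⁰) and is a
scalar by Schur's lemma. -/
theorem exists_eq_blockEnd (h : IsCartanVia ρ σ e) {w : Module.End ℂ S}
    (hw : ∀ a, involute a = a → w * ρ a = ρ a * w) :
    ∃ α β γ δ : ℂ, w = blockEnd e α β γ δ := by
  let w' : (F × F) →ₗ[ℂ] F × F := e.toLinearMap ∘ₗ w ∘ₗ e.symm.toLinearMap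
  have hw' : ∀ a, involute a = a → ∀ x : F × F,
      w' (σ a x.1, σ a x.2) = (σ a (w' x).1, σ a (w' x).2) := by
    intro a ha x
    have h1 := congrArg e (LinearMap.congr_fun (hw a ha) (e.symm x))
    rw [Module.End.mul_apply, Module.End.mul_apply, h.apply_eq, ha] at h1
    rw [← ((LinearEquiv.symm_apply_eq e).2 ?_ : e.symm (σ a x.1, σ a x.2) = ρ a (e.symm x))] at h1
    · exact h1
    · rw [h.apply_eq, ha, LinearEquiv.apply_symm_apply]
  have key : ∀ (p : F × F →ₗ[ℂ] F) (i : F →ₗ[ℂ] F × F),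
      (∀ a x, p (σ a x.1, σ a x.2) = σ a (p x)) →
      (∀ a x, i (σ a x) = (σ a (i x).1, σ a (i x).2)) →
      ∃ c : ℂ, p ∘ₗ w' ∘ₗ i = c • 1 := by
    intro p i hp hi
    refine h.isPauli.exists_eq_smul_one fun a ha => ?_
    ext x
    simp only [Module.End.mul_apply, LinearMap.comp_apply]
    rw [hi, hw' a ha, hp]
  obtain ⟨α, hα⟩ := key (LinearMap.fst ℂ F F) (LinearMap.inl ℂ F F) (by simp) (by simp)
  obtain ⟨β, hβ⟩ := key (LinearMap.fst ℂ F F) (LinearMap.inr ℂ F F) (by simp) (by simp)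
  obtain ⟨γ, hγ⟩ := key (LinearMap.snd ℂ F F) (LinearMap.inl ℂ F F) (by simp) (by simp)
  obtain ⟨δ, hδ⟩ := key (LinearMap.snd ℂ F F) (LinearMap.inr ℂ F F) (by simp) (by simp)
  refine ⟨α, β, γ, δ, ?_⟩
  ext s
  apply e.injective
  have hs : e (w s) = w' ((e s).1, 0) + w' (0, (e s).2) := by
    rw [← map_add]
    simp [w']
  have h1 := LinearMap.congr_fun hα (e s).1
  have h2 := LinearMap.congr_fun hβ (e s).2
  have h3 := LinearMap.congr_fun hγ (e s).1
  have h4 := LinearMap.congr_fun hδ (e s).2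
  simp only [LinearMap.comp_apply, LinearMap.inl_apply, LinearMap.inr_apply, LinearMap.fst_apply,
    LinearMap.snd_apply, LinearMap.smul_apply, Module.End.one_apply] at h1 h2 h3 h4
  rw [hs, blockEnd_apply, ← h1, ← h2, ← h3, ← h4]
  rfl

theorem diag_mul_map (h : IsCartanVia ρ σ e) (x y : ℂ) (a : CliffordAlgebra Q) :
    blockEnd e x 0 0 y * ρ a = ρ a * blockEnd e x 0 0 y := by
  ext s
  apply e.injective
  simp [h.apply_eq, blockEnd_apply]

/-- A vector v acts by σ(v) on one summand and by -σ(v) on the other; exchanging the summands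
changes the sign. -/
theorem antidiag_mem_anti (h : IsCartanVia ρ σ e) (x y : ℂ) :
    blockEnd e 0 x y 0 ∈ anti ρ := by
  intro v
  ext s
  apply e.injective
  simp [h.apply_eq, blockEnd_apply]

variable [FiniteDimensional ℝ V]

/-- For odd m the volume element is central, so Schur makes σ(η) a scalar z; being odd, it acts by
-z on the second summand. -/
theorem exists_volume (h : IsCartanVia ρ σ e) (hQ : Q.Nondegenerate)
    (hm : Odd (Module.finrank ℝ V)) :
    ∃ η ∈ pin Q, involute (η : CliffordAlgebra Q) = -(η : CliffordAlgebra Q) ∧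
      ∃ z : ℂ, z ≠ 0 ∧ ρ (η : CliffordAlgebra Q) = blockEnd e z 0 0 (-z) ∧
        σ (η : CliffordAlgebra Q) = z • 1 := by
  have := h.isPauli.nontrivial
  obtain ⟨η, hη, h1, h2⟩ := Lipschitz.exists_volume hQ
  rw [hm.neg_one_pow, neg_one_mul] at h1
  have hcomm : ∀ v, (η : CliffordAlgebra Q) * ι Q v = ι Q v * η := fun v => by
    rw [← neg_inj, ← h2, h1, neg_mul]
  have hσ : ∀ a, σ (η : CliffordAlgebra Q) * σ a = σ a * σ (η : CliffordAlgebra Q) :=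
    mul_map_of_commute σ fun v => by rw [← map_mul, ← map_mul, hcomm]
  obtain ⟨z, hz⟩ := h.isPauli.exists_eq_smul_one fun a _ => hσ a
  refine ⟨η, hη, h1, z, ?_, ?_, hz⟩
  · rintro rfl
    have h3 := map_mul_map_inv σ η
    rw [hz, zero_smul, zero_mul] at h3
    exact zero_ne_one h3
  · ext s
    apply e.injective
    rw [h.apply_eq, h1, map_neg, hz, blockEnd_apply]
    simp

/-- If ρ(a) = 0 then σ kills both a and α(a). Faithfulness on even elements first gives a + α(a) =
0, so a is odd; then it kills the even element a η, and η is a unit. -/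
theorem injective (h : IsCartanVia ρ σ e) (hQ : Q.Nondegenerate)
    (hm : Odd (Module.finrank ℝ V)) : Function.Injective ρ := by
  rw [injective_iff_map_eq_zero]
  intro a ha
  obtain ⟨η, -, hη, -⟩ := h.exists_volume hQ hm
  have h1 : σ a = 0 := by
    ext x
    have := congrArg Prod.fst (h.apply_eq a (e.symm (x, 0)))
    simpa [ha] using this.symm
  have h2 : σ (involute a) = 0 := by
    ext x
    have := congrArg Prod.snd (h.apply_eq a (e.symm (0, x)))
    simpa [ha] using this.symm
  have h3 : a + involute a = 0 := by
    refine h.isPauli.faithful _ ((mem_even_iff Q _).2 ?_) (by rw [map_add, h1, h2, add_zero])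
    rw [map_add, involute_involute, add_comm]
  have h4 : a * η = 0 := by
    refine h.isPauli.faithful _ ((mem_even_iff Q _).2 ?_) (by rw [map_mul, h1, zero_mul])
    rw [map_mul, hη, mul_neg, ← neg_mul, ← eq_neg_of_add_eq_zero_left h3]
  exact (Units.mul_left_eq_zero η).1 h4

/-- Commuting with ρ(η) = diag(z, -z) removes the off-diagonal blocks; likewise anticommuting with
it removes the diagonal ones. -/
theorem exists_eq_diag (h : IsCartanVia ρ σ e) (hQ : Q.Nondegenerate)
    (hm : Odd (Module.finrank ℝ V)) {w : Module.End ℂ S}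
    (hw : ∀ v, w * ρ (ι Q v) = ρ (ι Q v) * w) : ∃ x y : ℂ, w = blockEnd e x 0 0 y := by
  have := h.isPauli.nontrivial
  have hw' := mul_map_of_commute ρ hw
  obtain ⟨α, β, γ, δ, rfl⟩ := h.exists_eq_blockEnd fun a _ => hw' a
  obtain ⟨η, -, -, z, hz, hη, -⟩ := h.exists_volume hQ hm
  have h1 := hw' η
  rw [hη, blockEnd_mul, blockEnd_mul] at h1
  obtain ⟨-, h2, h3, -⟩ := blockEnd_injective e h1
  have hβ : z * β = 0 := by linear_combination -h2 / 2
  have hγ : z * γ = 0 := by linear_combination h3 / 2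
  rw [(mul_eq_zero.1 hβ).resolve_left hz, (mul_eq_zero.1 hγ).resolve_left hz]
  exact ⟨α, δ, rfl⟩

theorem exists_eq_antidiag (h : IsCartanVia ρ σ e) (hQ : Q.Nondegenerate)
    (hm : Odd (Module.finrank ℝ V)) {w : Module.End ℂ S} (hw : w ∈ anti ρ) :
    ∃ x y : ℂ, w = blockEnd e 0 x y 0 := by
  have := h.isPauli.nontrivial
  have hw' := mul_map_of_mem_anti ρ hw
  obtain ⟨α, β, γ, δ, rfl⟩ := h.exists_eq_blockEnd fun a ha => by rw [hw', ha]
  obtain ⟨η, -, hη', z, hz, hη, -⟩ := h.exists_volume hQ hm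
  have h1 := hw' η
  rw [hη', map_neg, hη, neg_mul, blockEnd_mul, blockEnd_mul, blockEnd_neg] at h1
  obtain ⟨h2, -, -, h3⟩ := blockEnd_injective e h1
  have hα : z * α = 0 := by linear_combination h2 / 2
  have hδ : z * δ = 0 := by linear_combination -h3 / 2
  rw [(mul_eq_zero.1 hα).resolve_left hz, (mul_eq_zero.1 hδ).resolve_left hz]
  exact ⟨β, γ, rfl⟩

/-- In odd dimension, the space `A(h)` is a hyperbolic plane. -/
theorem exists_anti_equiv (h : IsCartanVia ρ σ e) (hQ : Q.Nondegenerate)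
    (hm : Odd (Module.finrank ℝ V)) :
    ∃ L : (ℂ × ℂ) ≃ₗ[ℂ] anti ρ, ∀ x y, (L (x, y) : Module.End ℂ S) = blockEnd e 0 x y 0 := by
  have := h.isPauli.nontrivial
  let L : (ℂ × ℂ) →ₗ[ℂ] anti ρ :=
    { toFun := fun p => ⟨blockEnd e 0 p.1 p.2 0, h.antidiag_mem_anti _ _⟩
      map_add' := fun p p' => by
        ext s : 2
        apply e.injective
        rw [Submodule.coe_add, LinearMap.add_apply, map_add, blockEnd_apply, blockEnd_apply,
          blockEnd_apply]
        simp [add_smul]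
      map_smul' := fun c p => by
        ext s : 2
        apply e.injective
        simp [blockEnd_apply, mul_smul] }
  refine ⟨LinearEquiv.ofBijective L ⟨?_, ?_⟩, fun x y => rfl⟩
  · rintro ⟨x, y⟩ ⟨x', y'⟩ hxy
    obtain ⟨-, h1, h2, -⟩ := blockEnd_injective e (congrArg Subtype.val hxy)
    exact Prod.ext h1 h2
  · rintro ⟨w, hw⟩
    obtain ⟨x, y, rfl⟩ := h.exists_eq_antidiag hQ hm hw
    exact ⟨(x, y), rfl⟩

end IsCartanVia

end Odd

/-! ### Odd dimension: the semidirect product and its map onto the Lipschitz group. -/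

section CartanGroup

variable {V : Type*} [AddCommGroup V] [Module ℝ V] {Q : QuadraticForm ℝ V}

theorem involute_of_mem_spin {b : (CliffordAlgebra Q)ˣ} (hb : b ∈ spin Q) :
    involute (b : CliffordAlgebra Q) = b := (mem_even_iff Q _).1 hb.2

theorem involute_of_notMem_spin {b : (CliffordAlgebra Q)ˣ} (hb : b ∈ pin Q) (hb' : b ∉ spin Q) :
    involute (b : CliffordAlgebra Q) = -(b : CliffordAlgebra Q) :=
  (involute_of_mem_pin Q hb).resolve_left fun h => hb' ⟨hb, (mem_even_iff Q _).2 h⟩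

theorem notMem_spin_of_involute {b : (CliffordAlgebra Q)ˣ}
    (h : involute (b : CliffordAlgebra Q) = -(b : CliffordAlgebra Q)) : b ∉ spin Q := fun hb =>
  neg_ne Q b (h.symm.trans (involute_of_mem_spin hb))

theorem psi_apply_of_mem {b : pin Q} (hb : (b : (CliffordAlgebra Q)ˣ) ∈ spin Q)
    (x : ℂˣ × ℂˣ) : psi Q b x = x := by
  simp only [psi, MonoidHom.coe_mk, OneHom.coe_mk, if_pos hb, MulAut.one_apply]

theorem psi_apply_of_notMem {b : pin Q} (hb : (b : (CliffordAlgebra Q)ˣ) ∉ spin Q)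
    (x : ℂˣ × ℂˣ) : psi Q b x = (x.2, x.1) := by
  simp only [psi, MonoidHom.coe_mk, OneHom.coe_mk, if_neg hb]
  rfl

variable {S F : Type*} [AddCommGroup S] [Module ℂ S] [AddCommGroup F] [Module ℂ F]
  {ρ : CliffordAlgebra Q →ₐ[ℝ] Module.End ℂ S} {σ : CliffordAlgebra Q →ₐ[ℝ] Module.End ℂ F}
  {e : S ≃ₗ[ℂ] F × F}

/-- The units with diagonal block matrix. -/
def diagHom (e : S ≃ₗ[ℂ] F × F) : ℂˣ × ℂˣ →* Module.End ℂ S where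
  toFun x := blockEnd e x.1 0 0 x.2
  map_one' := blockEnd_one e
  map_mul' x y := by rw [blockEnd_mul]; simp

theorem diagHom_apply (x : ℂˣ × ℂˣ) : diagHom e x = blockEnd e x.1 0 0 x.2 := rfl

/-- An endomorphism that anticommutes with the vectors and has square `-1`. -/
def antiComplex (e : S ≃ₗ[ℂ] F × F) : Module.End ℂ S := blockEnd e 0 1 (-1) 0

theorem antiComplex_mul_self : antiComplex e * antiComplex e = -1 := by
  rw [antiComplex, blockEnd_mul, ← blockEnd_one e, blockEnd_neg]
  simp

namespace IsCartanVia

theorem antiComplex_mul_map (h : IsCartanVia ρ σ e) (a : CliffordAlgebra Q) :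
    antiComplex e * ρ a = ρ (involute a) * antiComplex e :=
  mul_map_of_mem_anti ρ (h.antidiag_mem_anti _ _) a

open Classical in
/-- The representation of the Pin group on `S ≃ F × F` in which the elements `b` outside the Spin
group act by `(s, t) ↦ (σ b t, σ b s)`. -/
noncomputable def twistHom (h : IsCartanVia ρ σ e) : pin Q →* Module.End ℂ S where
  toFun b := if (b : (CliffordAlgebra Q)ˣ) ∈ spin Q then
      ρ ((b : (CliffordAlgebra Q)ˣ) : CliffordAlgebra Q)
    else ρ ((b : (CliffordAlgebra Q)ˣ) : CliffordAlgebra Q) * antiComplex e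
  map_one' := by
    rw [if_pos (by simp)]
    simp
  map_mul' a b := by
    have hab := mul_mem_spin_iff Q a b
    have hm : ρ (((a * b : pin Q) : (CliffordAlgebra Q)ˣ) : CliffordAlgebra Q) =
        ρ ((a : (CliffordAlgebra Q)ˣ) : CliffordAlgebra Q) *
          ρ ((b : (CliffordAlgebra Q)ˣ) : CliffordAlgebra Q) := by
      rw [← map_mul]
      rfl
    have hJ := h.antiComplex_mul_map ((b : (CliffordAlgebra Q)ˣ) : CliffordAlgebra Q)
    by_cases ha : (a : (CliffordAlgebra Q)ˣ) ∈ spin Q <;>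
      by_cases hb : (b : (CliffordAlgebra Q)ˣ) ∈ spin Q <;>
      simp only [ha, hb, iff_true, iff_false, not_true_eq_false] at hab <;>
      simp only [ha, hb, hab, if_true, if_false, hm, mul_assoc]
    · rw [hJ, involute_of_mem_spin hb]
    -- For odd a and b, a J b J = -a b J²; this is why J must have square -1 rather than 1.
    · rw [← mul_assoc (antiComplex e), hJ, involute_of_notMem_spin b.2 hb, mul_assoc,
        antiComplex_mul_self, map_neg, neg_mul_neg, mul_one]

theorem twistHom_of_mem (h : IsCartanVia ρ σ e) {b : pin Q}
    (hb : (b : (CliffordAlgebra Q)ˣ) ∈ spin Q) :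
    h.twistHom b = ρ ((b : (CliffordAlgebra Q)ˣ) : CliffordAlgebra Q) := if_pos hb

theorem twistHom_of_notMem (h : IsCartanVia ρ σ e) {b : pin Q}
    (hb : (b : (CliffordAlgebra Q)ˣ) ∉ spin Q) :
    h.twistHom b = ρ ((b : (CliffordAlgebra Q)ˣ) : CliffordAlgebra Q) * antiComplex e :=
  if_neg hb

/-- For odd b, moving J past v gives the sign by which twisted conjugation differs from plain
conjugation. -/
theorem twistHom_mul_map (h : IsCartanVia ρ σ e) (b : pin Q) {v w : V}
    (hvw : involute ((b : (CliffordAlgebra Q)ˣ) : CliffordAlgebra Q) * ι Q v =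
      ι Q w * ((b : (CliffordAlgebra Q)ˣ) : CliffordAlgebra Q)) :
    h.twistHom b * ρ (ι Q v) = ρ (ι Q w) * h.twistHom b := by
  by_cases hb : (b : (CliffordAlgebra Q)ˣ) ∈ spin Q
  · rw [h.twistHom_of_mem hb, ← map_mul, ← map_mul, ← hvw, involute_of_mem_spin hb]
  · rw [h.twistHom_of_notMem hb, mul_assoc, h.antiComplex_mul_map, involute_ι, ← mul_assoc,
      ← mul_assoc, ← map_mul, ← map_mul, ← hvw, involute_of_notMem_spin b.2 hb, mul_neg, neg_mul]

/-- The representation of `(ℂˣ × ℂˣ) ⋊ Pin(h)` on `S`. -/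
noncomputable def swapHom (h : IsCartanVia ρ σ e) :
    (ℂˣ × ℂˣ) ⋊[psi Q] pin Q →* (Module.End ℂ S)ˣ :=
  SemidirectProduct.lift (diagHom e).toHomUnits h.twistHom.toHomUnits (by
    intro b
    ext1 x
    simp only [MonoidHom.comp_apply, MulEquiv.toMonoidHom_eq_coe, MonoidHom.coe_coe,
      MulAut.conj_apply]
    rw [eq_mul_inv_iff_mul_eq]
    apply Units.ext
    change diagHom e (psi Q b x) * h.twistHom b = h.twistHom b * diagHom e x
    by_cases hb : (b : (CliffordAlgebra Q)ˣ) ∈ spin Q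
    · rw [psi_apply_of_mem hb, h.twistHom_of_mem hb, diagHom_apply, h.diag_mul_map]
    -- ρ(b) commutes with diagonal matrices, while moving past J exchanges their two entries: this
    -- is ψ.
    · rw [psi_apply_of_notMem hb, h.twistHom_of_notMem hb, diagHom_apply, ← mul_assoc,
        h.diag_mul_map, mul_assoc, mul_assoc, diagHom_apply, antiComplex, blockEnd_mul,
        blockEnd_mul]
      simp)

theorem swapHom_apply (h : IsCartanVia ρ σ e) (x : (ℂˣ × ℂˣ) ⋊[psi Q] pin Q) :
    (h.swapHom x : Module.End ℂ S) = diagHom e x.left * h.twistHom x.right := rfl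

theorem swapHom_mem_lpin (h : IsCartanVia ρ σ e) (x : (ℂˣ × ℂˣ) ⋊[psi Q] pin Q) :
    h.swapHom x ∈ lpin ρ := by
  obtain ⟨h1, h2⟩ := conj_ι_of_mem_pin x.right.2
  have hsign : ∃ ε : ℝ, ε * ε = 1 ∧
      involute ((x.right : (CliffordAlgebra Q)ˣ) : CliffordAlgebra Q) =
        ε • ((x.right : (CliffordAlgebra Q)ˣ) : CliffordAlgebra Q) := by
    rcases involute_of_mem_pin Q x.right.2 with h | h
    · exact ⟨1, by simp, by simp [h]⟩
    · exact ⟨-1, by simp, by simp [h]⟩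
  obtain ⟨ε, hε, hinv⟩ := hsign
  refine (mem_lpin_iff ρ).2 ⟨fun v => ?_, fun v => ?_⟩
  · obtain ⟨w, hw⟩ := h1 v
    refine ⟨ε • w, ?_⟩
    rw [swapHom_apply, mul_assoc, h.twistHom_mul_map x.right (w := ε • w), ← mul_assoc,
      diagHom_apply, h.diag_mul_map, mul_assoc]
    rw [hinv, smul_mul_assoc, hw, map_smul, smul_mul_assoc]
  · obtain ⟨w, hw⟩ := h2 v
    refine ⟨ε • w, ?_⟩
    rw [swapHom_apply, mul_assoc, h.twistHom_mul_map x.right (w := v), ← mul_assoc,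
      diagHom_apply, ← h.diag_mul_map, mul_assoc]
    rw [hinv, map_smul, smul_mul_smul_comm, hε, one_smul, hw]

/-- The homomorphism from `(ℂˣ × ℂˣ) ⋊ Pin(h)` onto the Lipschitz group. -/
noncomputable def swapLpinHom (h : IsCartanVia ρ σ e) :
    (ℂˣ × ℂˣ) ⋊[psi Q] pin Q →* lpin ρ :=
  h.swapHom.codRestrict (lpin ρ) h.swapHom_mem_lpin

theorem swapLpinHom_apply (h : IsCartanVia ρ σ e) (x : (ℂˣ × ℂˣ) ⋊[psi Q] pin Q) :
    ((h.swapLpinHom x : (Module.End ℂ S)ˣ) : Module.End ℂ S) =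
      diagHom e x.left * h.twistHom x.right := rfl

variable [FiniteDimensional ℝ V]

theorem swapLpinHom_surjective (h : IsCartanVia ρ σ e) (hQ : Q.Nondegenerate)
    (hm : Odd (Module.finrank ℝ V)) : Function.Surjective h.swapLpinHom := by
  have := h.nontrivial
  have := h.isPauli.nontrivial
  rintro ⟨a, ha⟩
  obtain ⟨T, hT, haT⟩ := exists_isometry_of_mem_lpin ρ hQ ha
  obtain ⟨b, hb, hbT⟩ := isTwistedConj_of_isometry hQ T hT
  set t : (Module.End ℂ S)ˣ := h.twistHom.toHomUnits ⟨b, hb⟩ with ht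
  have htT : ∀ v, (t : Module.End ℂ S) * ρ (ι Q v) = ρ (ι Q (T v)) * t := fun v =>
    h.twistHom_mul_map ⟨b, hb⟩ (hbT v)
  obtain ⟨x, y, hxy⟩ := h.exists_eq_diag hQ hm (inv_mul_commute ρ haT htT)
  -- The inverse of the remaining factor is diagonal too, so both entries are nonzero.
  obtain ⟨x', y', hxy'⟩ := h.exists_eq_diag hQ hm (inv_mul_commute ρ htT haT)
  have hone : blockEnd e x 0 0 y * blockEnd e x' 0 0 y' = blockEnd e 1 0 0 1 := by
    rw [← hxy, ← hxy', ← Units.val_mul, blockEnd_one, mul_assoc, mul_inv_cancel_left,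
      inv_mul_cancel, Units.val_one]
  rw [blockEnd_mul] at hone
  obtain ⟨h1, -, -, h2⟩ := blockEnd_injective e hone
  have hx : x ≠ 0 := by
    rintro rfl
    simp at h1
  have hy : y ≠ 0 := by
    rintro rfl
    simp at h2
  refine ⟨⟨1, ⟨b, hb⟩⟩ * ⟨(Units.mk0 x hx, Units.mk0 y hy), 1⟩, Subtype.ext (Units.ext ?_)⟩
  rw [map_mul]
  change (diagHom e 1 * h.twistHom _) * (diagHom e _ * h.twistHom 1) = _
  rw [map_one, map_one, one_mul, mul_one, diagHom_apply, Units.val_mk0, Units.val_mk0, ← hxy]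
  change ((t * (t⁻¹ * a) : (Module.End ℂ S)ˣ) : Module.End ℂ S) = a
  rw [mul_inv_cancel_left]

theorem eq_one_or_neg_one_of_even (h : IsCartanVia ρ σ e) (hQ : Q.Nondegenerate)
    (hm : Odd (Module.finrank ℝ V)) {b : (CliffordAlgebra Q)ˣ} (hb : b ∈ pin Q)
    (heven : involute (b : CliffordAlgebra Q) = b)
    (hc : ∀ v, ρ (b : CliffordAlgebra Q) * ρ (ι Q v) = ρ (ι Q v) * ρ (b : CliffordAlgebra Q)) :
    b = 1 ∨ b = -1 :=
  eq_one_or_neg_one_of_mem_pin hb (mem_span_one_of_central_even hQ heven fun v =>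
    h.injective hQ hm (by rw [map_mul, map_mul, hc]))

/-- If b is odd, its image times a diagonal matrix is block antidiagonal and cannot be the identity.
If b is even, ρ(b) inverts a diagonal matrix, hence commutes with V, and b = ±1. -/
theorem swapLpinHom_ker (h : IsCartanVia ρ σ e) (hQ : Q.Nondegenerate)
    (hm : Odd (Module.finrank ℝ V)) : h.swapLpinHom.ker = signTriples Q := by
  have := h.isPauli.nontrivial
  ext x
  rw [MonoidHom.mem_ker]
  constructor
  · intro hx
    have h1 : diagHom e x.left * h.twistHom x.right = 1 :=
      congrArg (fun y : lpin ρ => ((y : (Module.End ℂ S)ˣ) : Module.End ℂ S)) hx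
    have hspin : (x.right : (CliffordAlgebra Q)ˣ) ∈ spin Q := by
      by_contra hb
      rw [h.twistHom_of_notMem hb, diagHom_apply, ← mul_assoc, h.diag_mul_map, mul_assoc] at h1
      have hX : blockEnd e x.left.1 0 0 x.left.2 * antiComplex e =
          blockEnd e 0 x.left.1 (-x.left.2) 0 := by
        rw [antiComplex, blockEnd_mul]
        simp
      -- The left side of `h1` is block antidiagonal and so anticommutes with diag(1, -1), whereas
      -- the identity commutes with it.
      have h2 := congrArg (fun y => blockEnd e 1 0 0 (-1) * y) h1
      have h3 := congrArg (fun y => y * blockEnd e 1 0 0 (-1)) h1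
      simp only [mul_one, one_mul, hX] at h2 h3
      rw [← mul_assoc, h.diag_mul_map, mul_assoc, blockEnd_mul] at h2
      rw [mul_assoc, blockEnd_mul] at h3
      have h4 : blockEnd e 1 0 0 (-1) = -blockEnd e 1 0 0 (-1) := by
        nth_rewrite 1 [← h2]
        rw [← h3, ← mul_neg, blockEnd_neg]
        simp
      rw [blockEnd_neg] at h4
      have h5 := (blockEnd_injective e h4).1
      norm_num at h5
    rw [h.twistHom_of_mem hspin] at h1
    have hinv : ρ ((x.right : (CliffordAlgebra Q)ˣ) : CliffordAlgebra Q) =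
        blockEnd e (x.left.1⁻¹ : ℂˣ) 0 0 (x.left.2⁻¹ : ℂˣ) := by
      have h2 : blockEnd e (x.left.1⁻¹ : ℂˣ) 0 0 (x.left.2⁻¹ : ℂˣ) * diagHom e x.left = 1 := by
        rw [diagHom_apply, blockEnd_mul, ← blockEnd_one e]
        simp
      exact (left_inv_eq_right_inv h2 h1).symm
    rcases h.eq_one_or_neg_one_of_even hQ hm x.right.2 (involute_of_mem_spin hspin)
      (fun v => by rw [hinv, h.diag_mul_map]) with hb | hb
    · left
      refine ⟨?_, hb⟩
      rw [hb, Units.val_one, map_one, mul_one, diagHom_apply, ← blockEnd_one e] at h1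
      obtain ⟨h2, -, -, h3⟩ := blockEnd_injective e h1
      exact Prod.ext (Units.ext h2) (Units.ext h3)
    · right
      refine ⟨?_, hb⟩
      rw [hb, Units.val_neg, Units.val_one, map_neg, map_one, mul_neg_one, neg_eq_iff_eq_neg,
        diagHom_apply, ← blockEnd_one e, blockEnd_neg] at h1
      obtain ⟨h2, -, -, h3⟩ := blockEnd_injective e h1
      exact Prod.ext (Units.ext h2) (Units.ext h3)
  · have hspin : ∀ h' : (x.right : (CliffordAlgebra Q)ˣ) = -1,
        (x.right : (CliffordAlgebra Q)ˣ) ∈ spin Q := fun h' =>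
      ⟨x.right.2, (mem_even_iff Q _).2 (by rw [h']; simp)⟩
    rintro (⟨h1, h2⟩ | ⟨h1, h2⟩)
    · have hx : x = 1 := SemidirectProduct.ext h1 (Subtype.ext h2)
      rw [hx, map_one]
    · apply Subtype.ext
      apply Units.ext
      rw [swapLpinHom_apply, h.twistHom_of_mem (hspin h2), h1, h2, diagHom_apply]
      change blockEnd e ((-1 : ℂˣ) : ℂ) 0 0 ((-1 : ℂˣ) : ℂ) * _ = 1
      rw [Units.val_neg (1 : (CliffordAlgebra Q)ˣ), Units.val_one, map_neg, map_one, mul_neg_one,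
        blockEnd_neg, ← blockEnd_one e]
      simp

theorem nonempty_pinSwap_equiv (h : IsCartanVia ρ σ e) (hQ : Q.Nondegenerate)
    (hm : Odd (Module.finrank ℝ V)) : Nonempty (PinSwap Q ≃* lpin ρ) :=
  ⟨(QuotientGroup.quotientMulEquivOfEq (h.swapLpinHom_ker hQ hm).symm).trans
    (QuotientGroup.quotientKerEquivOfSurjective _ (h.swapLpinHom_surjective hQ hm))⟩

/-- The volume element is now central, so J takes over the role of detecting parity. -/
theorem eq_one_or_neg_one (h : IsCartanVia ρ σ e) (hQ : Q.Nondegenerate)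
    (hm : Odd (Module.finrank ℝ V)) (c : ℂ) (b : (CliffordAlgebra Q)ˣ) (hb : b ∈ pin Q)
    (hcb : c • ρ (b : CliffordAlgebra Q) = 1) : (c = 1 ∧ b = 1) ∨ (c = -1 ∧ b = -1) := by
  have := h.nontrivial
  have hone : ∀ d : ℂ, d • (1 : Module.End ℂ S) = 1 → d = 1 := fun d hd =>
    smul_left_injective ℂ (one_ne_zero (α := Module.End ℂ S)) (by simpa using hd)
  have hc : c ≠ 0 := by
    rintro rfl
    rw [zero_smul] at hcb
    exact zero_ne_one hcb
  have hρb : ρ (b : CliffordAlgebra Q) = c⁻¹ • 1 := by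
    rw [← hcb, smul_smul, inv_mul_cancel₀ hc, one_smul]
  have heven : involute (b : CliffordAlgebra Q) = b := by
    refine (involute_of_mem_pin Q hb).resolve_right fun hodd => ?_
    have h1 := h.antiComplex_mul_map (b : CliffordAlgebra Q)
    rw [hodd, map_neg, hρb, neg_mul, mul_smul_comm, smul_mul_assoc, mul_one, one_mul,
      ← smul_neg] at h1
    have h2 := smul_right_injective _ (inv_ne_zero hc) h1
    have h3 : (2 : ℂ) • antiComplex e = 0 := by
      rw [two_smul]
      exact eq_neg_iff_add_eq_zero.1 h2
    have h4 := (smul_eq_zero.1 h3).resolve_left two_ne_zero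
    have h5 := antiComplex_mul_self (e := e)
    rw [h4, mul_zero] at h5
    exact one_ne_zero (neg_eq_zero.1 h5.symm)
  rcases h.eq_one_or_neg_one_of_even hQ hm hb heven fun v => by
    rw [hρb, mul_smul_comm, smul_mul_assoc, mul_one, one_mul] with rfl | rfl
  · refine Or.inl ⟨hone c ?_, rfl⟩
    simpa using hcb
  · refine Or.inr ⟨?_, rfl⟩
    rw [← neg_eq_iff_eq_neg]
    exact hone _ (by simpa using hcb)

theorem mul_self_antidiag {w : Module.End ℂ S} {x y : ℂ} (hw : w = blockEnd e 0 x y 0) :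
    w * w = (x * y) • 1 := by
  rw [hw, blockEnd_mul, ← blockEnd_one e, blockEnd_smul]
  simp [mul_comm]

theorem mul_self_eq (h : IsCartanVia ρ σ e) (hQ : Q.Nondegenerate)
    (hm : Odd (Module.finrank ℝ V)) (w : anti ρ) :
    (w : Module.End ℂ S) * w = antiForm ρ w • (1 : Module.End ℂ S) := by
  have := h.nontrivial
  have := h.finiteDimensional
  obtain ⟨x, y, hw⟩ := h.exists_eq_antidiag hQ hm w.2
  have h1 := mul_self_antidiag hw
  rw [antiForm_of_sq ρ h1, h1]

/-- The values of `κ` on the products of diagonal matrices and elements of the Pin group. -/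
theorem exists_orthogonalGroup_equiv (h : IsCartanVia ρ σ e) (hQ : Q.Nondegenerate)
    (hm : Odd (Module.finrank ℝ V)) :
    ∃ f : orthogonalGroup (antiForm ρ) ≃* ℂˣ ⋊[phi] ℤˣ,
      (∀ T : orthogonalGroup (antiForm ρ),
        (∀ w, (T : anti ρ ≃ₗ[ℂ] anti ρ) w = -w) → f T = ⟨-1, 1⟩) ∧
      (∀ x : (ℂˣ × ℂˣ) ⋊[psi Q] pin Q, (x.right : (CliffordAlgebra Q)ˣ) ∈ spin Q →
        f (kappa ρ (h.swapLpinHom x)) = ⟨x.left.1 * x.left.2⁻¹, 1⟩) ∧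
      ∀ x : (ℂˣ × ℂˣ) ⋊[psi Q] pin Q, (x.right : (CliffordAlgebra Q)ˣ) ∉ spin Q →
        f (kappa ρ (h.swapLpinHom x)) = ⟨x.left.1 * x.left.2⁻¹, -1⟩ := by
  have := h.nontrivial
  have := h.finiteDimensional
  obtain ⟨L, hL⟩ := h.exists_anti_equiv hQ hm
  obtain ⟨f, hf⟩ := exists_orthogonalGroup_equiv_semidirect L fun x y =>
    antiForm_of_sq ρ (mul_self_antidiag (hL x y))
  refine ⟨f, fun T hT => (hf T _).1 fun x y => ?_, fun x hx => (hf _ _).1 fun β γ => ?_,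
    fun x hx => (hf _ _).2 fun β γ => ?_⟩
  · rw [hT, ← map_neg]
    congr 1
    simp
  -- Conjugation by diag(λ, μ) multiplies the two antidiagonal entries by λ/μ and μ/λ; an even b
  -- acts trivially.
  · refine kappa_apply_eq ρ ?_
    rw [swapLpinHom_apply, h.twistHom_of_mem hx, hL, hL, diagHom_apply, h.diag_mul_map, mul_assoc,
      ← mul_assoc (blockEnd e 0 _ _ 0), mul_map_of_mem_anti ρ (h.antidiag_mem_anti _ _),
      involute_of_mem_spin hx, mul_assoc, blockEnd_mul, blockEnd_mul]
    congr 2 <;> simp <;> field_simp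
  -- Here J swaps the entries with a minus sign, and the odd b contributes another; the signs
  -- cancel.
  · refine kappa_apply_eq ρ ?_
    rw [swapLpinHom_apply, h.twistHom_of_notMem hx, hL, hL, diagHom_apply, ← mul_assoc,
      h.diag_mul_map]
    simp only [mul_assoc]
    rw [← mul_assoc (blockEnd e 0 _ _ 0),
      mul_map_of_mem_anti ρ (h.antidiag_mem_anti _ _),
      involute_of_notMem_spin x.right.2 hx, map_neg, neg_mul, ← mul_neg, mul_assoc, antiComplex,
      blockEnd_mul, blockEnd_mul, blockEnd_mul, blockEnd_neg, blockEnd_mul]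
    congr 2 <;> simp <;> field_simp

end IsCartanVia

end CartanGroup

/-! ### Odd dimension: the two exact sequences. -/

section CartanExtensions

variable {V : Type*} [AddCommGroup V] [Module ℝ V] {Q : QuadraticForm ℝ V}
  {S F : Type*} [AddCommGroup S] [Module ℂ S] [AddCommGroup F] [Module ℂ F]
  {ρ : CliffordAlgebra Q →ₐ[ℝ] Module.End ℂ S} {σ : CliffordAlgebra Q →ₐ[ℝ] Module.End ℂ F}
  {e : S ≃ₗ[ℂ] F × F} [FiniteDimensional ℝ V]

theorem squareRight_mk (z : ℂˣ) (ε : ℤˣ) : squareRight ⟨z, ε⟩ = ⟨z ^ 2, ε⟩ := rfl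

namespace IsCartanVia

/-- With κ given by λ/μ and the parity of b, its kernel is λ = μ with b in Spin, that is ℂˣ · Spin.
Squaring the second coordinate also admits λ = -μ, and diag(λ, -λ) is a multiple of ρ(η), which
enlarges Spin to Pin. -/
theorem exists_extensions (h : IsCartanVia ρ σ e) (hQ : Q.Nondegenerate)
    (hpos : 0 < Module.finrank ℝ V) (hm : Odd (Module.finrank ℝ V)) :
    ∃ f : orthogonalGroup (antiForm ρ) ≃* ℂˣ ⋊[phi] ℤˣ,
      (∃ E : GroupExtension (ScalarDot Q (pin Q)) (lpin ρ) (ℂˣ ⋊[phi] ℤˣ),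
        (∀ (c : ℂˣ) (a : pin Q),
          ((E.inl (QuotientGroup.mk (c, a)) : (Module.End ℂ S)ˣ) : Module.End ℂ S) =
            (c : ℂ) • ρ ((a : (CliffordAlgebra Q)ˣ) : CliffordAlgebra Q)) ∧
        E.rightHom = (squareRight.comp f.toMonoidHom).comp (kappa ρ)) ∧
      (∃ E : GroupExtension (ScalarDot Q (spin Q)) (lpin ρ) (ℂˣ ⋊[phi] ℤˣ),
        (∀ (c : ℂˣ) (a : spin Q),
          ((E.inl (QuotientGroup.mk (c, a)) : (Module.End ℂ S)ˣ) : Module.End ℂ S) =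
            (c : ℂ) • ρ ((a : (CliffordAlgebra Q)ˣ) : CliffordAlgebra Q)) ∧
        E.rightHom = f.toMonoidHom.comp (kappa ρ)) := by
  obtain ⟨f, hneg, heven, hodd⟩ := h.exists_orthogonalGroup_equiv hQ hm
  obtain ⟨u, hu, hu', -⟩ := exists_odd_mem_pin hQ hpos
  have hscalar : ∀ (c : ℂˣ) (b : pin Q), (b : (CliffordAlgebra Q)ˣ) ∈ spin Q →
      f (kappa ρ (scalarMulHom ρ (c, b))) = 1 := fun c b hb => by
    rw [kappa_scalarMulHom_even ρ (c, b) (involute_of_mem_spin hb), map_one]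
  -- An odd element of Pin acts on the plane as -id, i.e. as the scaling by z = -1, which squaring
  -- kills.
  have hscalar' : ∀ (c : ℂˣ) (b : pin Q), (b : (CliffordAlgebra Q)ˣ) ∉ spin Q →
      f (kappa ρ (scalarMulHom ρ (c, b))) = ⟨-1, 1⟩ := fun c b hb =>
    hneg _ (kappa_scalarMulHom_odd ρ (c, b) (involute_of_notMem_spin b.2 hb))
  have hsurj : ∀ y, ∃ a, f (kappa ρ a) = y := by
    rintro ⟨z, ε⟩
    rcases Int.units_eq_one_or ε with rfl | rfl
    · exact ⟨h.swapLpinHom ⟨(z, 1), 1⟩, by rw [heven _ (one_mem _)]; simp⟩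
    · refine ⟨h.swapLpinHom ⟨(z, 1), ⟨u, hu⟩⟩, ?_⟩
      rw [hodd _ (notMem_spin_of_involute hu')]
      simp
  have hdiag : ∀ x : (ℂˣ × ℂˣ) ⋊[psi Q] pin Q, (x.right : (CliffordAlgebra Q)ˣ) ∈ spin Q →
      x.left.1 = x.left.2 → h.swapLpinHom x = scalarMulHom ρ (x.left.1, x.right) := by
    intro x hx hxx
    apply Subtype.ext
    apply Units.ext
    rw [swapLpinHom_apply, scalarMulHom_apply, h.twistHom_of_mem hx, diagHom_apply, ← hxx,
      ← one_mul (ρ _), ← smul_mul_assoc, ← blockEnd_one e, blockEnd_smul]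
    simp [blockEnd_one]
  have hantidiag : ∀ x : (ℂˣ × ℂˣ) ⋊[psi Q] pin Q, (x.right : (CliffordAlgebra Q)ˣ) ∈ spin Q →
      x.left.1 = -x.left.2 → ∃ y, h.swapLpinHom x = scalarMulHom ρ y := by
    intro x hx hxx
    obtain ⟨η, hη, -, z, hz, hηz, -⟩ := h.exists_volume hQ hm
    -- Since ρ(η) = diag(z, -z), the scalar λ/z turns it into diag(λ, -λ).
    refine ⟨(x.left.1 * (Units.mk0 z hz)⁻¹, ⟨η, hη⟩ * x.right), ?_⟩
    apply Subtype.ext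
    apply Units.ext
    have hx2 : (x.left.2 : ℂ) = -x.left.1 := by rw [hxx]; simp
    rw [swapLpinHom_apply, scalarMulHom_apply, h.twistHom_of_mem hx, diagHom_apply,
      Subgroup.coe_mul, Units.val_mul, Units.val_mul, map_mul, hηz, ← smul_mul_assoc, blockEnd_smul, hx2]
    congr 2 <;> simp [hz]
  refine ⟨f, ⟨⟨scalarDotHom ρ (pin Q) le_rfl, (squareRight.comp f.toMonoidHom).comp (kappa ρ),
    scalarDotHom_injective ρ _ _ (h.eq_one_or_neg_one hQ hm), ?_, ?_⟩,
    scalarDotHom_mk ρ _ _, rfl⟩, ⟨scalarDotHom ρ (spin Q) spin_le_pin,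
    f.toMonoidHom.comp (kappa ρ),
    scalarDotHom_injective ρ _ _ (h.eq_one_or_neg_one hQ hm), ?_, hsurj⟩,
    scalarDotHom_mk ρ _ _, rfl⟩
  · ext a
    rw [MonoidHom.mem_range, MonoidHom.mem_ker]
    constructor
    · rintro ⟨x, rfl⟩
      induction x using QuotientGroup.induction_on with
      | H x =>
        change squareRight (f (kappa ρ (scalarMulHom ρ (x.1, x.2)))) = 1
        by_cases hx : (x.2 : (CliffordAlgebra Q)ˣ) ∈ spin Q
        · rw [hscalar _ _ hx, map_one]
        · rw [hscalar' _ _ hx, squareRight_mk, neg_one_sq]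
          rfl
    · intro ha
      obtain ⟨x, rfl⟩ := h.swapLpinHom_surjective hQ hm a
      change squareRight (f (kappa ρ (h.swapLpinHom x))) = 1 at ha
      by_cases hx : (x.right : (CliffordAlgebra Q)ˣ) ∈ spin Q
      · rw [heven x hx, squareRight_mk] at ha
        have h1 : (x.left.1 * x.left.2⁻¹) ^ 2 = 1 := congrArg SemidirectProduct.left ha
        have h2 : x.left.1 * x.left.2⁻¹ = 1 ∨ x.left.1 * x.left.2⁻¹ = -1 := by
          rw [Units.ext_iff, Units.val_pow_eq_pow_val, Units.val_one, pow_two, mul_self_eq_one_iff] at h1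
          exact h1.imp Units.ext Units.ext
        rcases h2 with h2 | h2
        · exact ⟨QuotientGroup.mk (x.left.1, x.right), (hdiag x hx (mul_inv_eq_one.1 h2)).symm⟩
        · obtain ⟨y, hy⟩ := hantidiag x hx (by rw [mul_inv_eq_iff_eq_mul.1 h2, neg_one_mul])
          exact ⟨QuotientGroup.mk y, hy.symm⟩
      · rw [hodd x hx, squareRight_mk] at ha
        have h1 : (-1 : ℤˣ) = 1 := congrArg SemidirectProduct.right ha
        exact absurd h1 (by decide)
  · rintro ⟨z, ε⟩
    -- Surjectivity of q ∘ κ reduces to that of κ through a complex square root of z.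
    obtain ⟨c, hc⟩ := IsAlgClosed.exists_pow_nat_eq (z : ℂ) (n := 2) two_pos
    have hc0 : c ≠ 0 := by
      rintro rfl
      exact z.ne_zero (by rw [← hc]; simp)
    obtain ⟨a, ha⟩ := hsurj ⟨Units.mk0 c hc0, ε⟩
    refine ⟨a, ?_⟩
    change squareRight (f (kappa ρ a)) = _
    rw [ha, squareRight_mk]
    congr 1
    exact Units.ext hc
  · ext a
    rw [MonoidHom.mem_range, MonoidHom.mem_ker]
    constructor
    · rintro ⟨x, rfl⟩
      induction x using QuotientGroup.induction_on with
      | H x => exact hscalar x.1 ⟨x.2, spin_le_pin x.2.2⟩ x.2.2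
    · intro ha
      obtain ⟨x, rfl⟩ := h.swapLpinHom_surjective hQ hm a
      change f (kappa ρ (h.swapLpinHom x)) = 1 at ha
      by_cases hx : (x.right : (CliffordAlgebra Q)ˣ) ∈ spin Q
      · rw [heven x hx] at ha
        have h1 : x.left.1 * x.left.2⁻¹ = 1 := congrArg SemidirectProduct.left ha
        exact ⟨QuotientGroup.mk (x.left.1, ⟨x.right, hx⟩),
          (hdiag x hx (mul_inv_eq_one.1 h1)).symm⟩
      · rw [hodd x hx] at ha
        have h1 : (-1 : ℤˣ) = 1 := congrArg SemidirectProduct.right ha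
        exact absurd h1 (by decide)

end IsCartanVia

end CartanExtensions

end Lipschitz

/-! ### The theorem in both parities. -/

theorem theorem1 {V : Type*} [AddCommGroup V] [Module ℝ V] [FiniteDimensional ℝ V]
    (Q : QuadraticForm ℝ V) (hQ : Q.Nondegenerate) (hpos : 0 < Module.finrank ℝ V)
    {S : Type*} [AddCommGroup S] [Module ℂ S]
    (ρ : CliffordAlgebra Q →ₐ[ℝ] Module.End ℂ S) :
    (Even (Module.finrank ℝ V) → IsDirac ρ →
      (∀ w : anti ρ, (w : Module.End ℂ S) * w = antiForm ρ w • (1 : Module.End ℂ S)) ∧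
      (∃ e : orthogonalGroup (antiForm ρ) ≃* ℤˣ,
        ∃ E : GroupExtension (ScalarDot Q (spin Q)) (lpin ρ) ℤˣ,
          (∀ (c : ℂˣ) (a : spin Q),
            ((E.inl (QuotientGroup.mk (c, a)) : (Module.End ℂ S)ˣ) : Module.End ℂ S) =
              (c : ℂ) • ρ ((a : (CliffordAlgebra Q)ˣ) : CliffordAlgebra Q)) ∧
          E.rightHom = e.toMonoidHom.comp (kappa ρ) ∧
          Nonempty E.Splitting) ∧
      (∃ f : ScalarDot Q (pin Q) ≃* lpin ρ,
        ∀ (c : ℂˣ) (a : pin Q),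
          ((f (QuotientGroup.mk (c, a)) : (Module.End ℂ S)ˣ) : Module.End ℂ S) =
            (c : ℂ) • ρ ((a : (CliffordAlgebra Q)ˣ) : CliffordAlgebra Q))) ∧
    (Odd (Module.finrank ℝ V) → IsCartan ρ →
      (∀ w : anti ρ, (w : Module.End ℂ S) * w = antiForm ρ w • (1 : Module.End ℂ S)) ∧
      (∃ e : orthogonalGroup (antiForm ρ) ≃* ℂˣ ⋊[phi] ℤˣ,
        (∃ E : GroupExtension (ScalarDot Q (pin Q)) (lpin ρ) (ℂˣ ⋊[phi] ℤˣ),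
          (∀ (c : ℂˣ) (a : pin Q),
            ((E.inl (QuotientGroup.mk (c, a)) : (Module.End ℂ S)ˣ) : Module.End ℂ S) =
              (c : ℂ) • ρ ((a : (CliffordAlgebra Q)ˣ) : CliffordAlgebra Q)) ∧
          E.rightHom = (squareRight.comp e.toMonoidHom).comp (kappa ρ)) ∧
        (∃ E : GroupExtension (ScalarDot Q (spin Q)) (lpin ρ) (ℂˣ ⋊[phi] ℤˣ),
          (∀ (c : ℂˣ) (a : spin Q),
            ((E.inl (QuotientGroup.mk (c, a)) : (Module.End ℂ S)ˣ) : Module.End ℂ S) =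
              (c : ℂ) • ρ ((a : (CliffordAlgebra Q)ˣ) : CliffordAlgebra Q)) ∧
          E.rightHom = e.toMonoidHom.comp (kappa ρ))) ∧
      Nonempty (PinSwap Q ≃* lpin ρ)) := by
  constructor
  · intro hm hρ
    exact ⟨hρ.mul_self_eq hQ hm, hρ.exists_split_extension hQ hpos hm,
      hρ.exists_scalarDot_equiv hQ hm⟩
  · rintro hm ⟨σ, hσ, e, he⟩
    have h : IsCartanVia ρ σ e := ⟨hσ, he⟩
    exact ⟨h.mul_self_eq hQ hm, h.exists_extensions hQ hpos hm, h.nonempty_pinSwap_equiv hQ hm⟩
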